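/- Let $g_2,g_3\in\mathbb R$ with $\Delta=g_2^3-27g_3^2>0$, let $\wp,\zeta,\sigma$ be the Weierstrass functions with invariants $g_2,g_3$, and let $w>0$ and $w'\in i\mathbb R_{>0}$ be the fundamental half-periods, so that the period lattice is $\Lambda=2w\mathbb Z+2w'\mathbb Z$. For $X\in\mathbb R$ put $$\widetilde\Psi_X(k)=\frac{\sigma(X+k+w')}{\sigma(X+w')\sigma(k)}e^{-\zeta(k)X-\zeta(w')k},\qquad \widetilde\Psi_X(k,l)=\frac{\sigma(X+k+l+w')}{\sigma(X+w')\sigma(k+l)}e^{-(\zeta(k)+\zeta(l))X-\zeta(w')(k+l)} .$$ Let $b_0\in\mathbb R$. Let $K$ be a set of spectral parameters, $L_1,L_2\subseteq K$, and for $j=1,2$ let $d\lambda_j=\rho_j\,dm_j$ be a measure on $L_j$ ($m_j$ a positive measure concentrated on $L_j$, $\rho_j$ a density), and let $\omega_j(l)$, $l\in L_j$, be roots of $$2\wp'(z)+b_0\wp(z)=2\wp'(l)+b_0\wp(l)$$ such that, modulo $\Lambda$, $\omega_1(l)\ne\omega_2(l)$ for $l\in L_1\cap L_2$, and $k\neq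 0$, $\omega_j(l)\ne 0$, $k\ne\omega_j(l)$ for all $k\in K$, $l\in L_j$ (in particular $\omega_j(l)\neq l$). Put $\mu_k(Y)=\mu_0(k)e^{\wp(k)Y}$ and $\gamma_{-\omega_j(l)}(Y)=\gamma_0(\omega_j(l))e^{-\wp(\omega_j(l))Y}$. Assume that all data are real: either $K\subset\mathbb R$ and $\omega_j(l)$, $\mu_0(k)$, $\gamma_0(\omega_j(l))$, $\rho_j(l)$ are real for $k\in K$, $l\in L_j$, or, more generally (so as to include closed contours), $K\subset\mathbb C$ and $K,L_j,m_j$ are invariant and $\omega_j,\mu_0,\gamma_0\circ\omega_j,\rho_j$ equivariant under complex conjugation, with $\gamma_0(\overline{\omega_j(l)})=\overline{\gamma_0(\omega_j(l))}$. Let $\psi(X,Y;k)$ satisfy, for all $X,Y\in\mathbb R$ and $k\in K$, $$\psi(X,Y;k)+\mu_k(Y)\sum_{j=1}^2\int_{L_j}\psi(X,Y;l)\,\gamma_{-\omega_j(l)}(Y)\,\widetilde\Psi_X(k,-\omega_j(l))\,d\lambda_j(l)=\mu_k(Y)\widetilde\Psi_X(k).$$ Assume that, for all $X,Y\in\mathbb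 R$, the corresponding homogeneous equation (right-hand side $0$) has only the zero solution on $K$ among the functions for which the integrals exist, and that differentiation in $(X,Y)$, to all orders, commutes with the integrals above and with those in the next formula. Then $$u(X,Y)=-2\wp(X+w')-2\,\partial_X\sum_{j=1}^2\int_{L_j}\psi(X,Y;l)\,\gamma_{-\omega_j(l)}(Y)\,\widetilde\Psi_X(-\omega_j(l))\,d\lambda_j(l)$$ is a real-valued, non-singular ($C^\infty$ on all of $\mathbb R^2$) solution of the extended Boussinesq equation $$(b_0u_Y+u_{XXX}+6uu_X)_X+3u_{YY}=0 .$$ -/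

import Mathlib

open MeasureTheory
open scoped ContDiff ComplexConjugate

noncomputable section

namespace EllipticDL

/-- Weierstrass `ζ`-function of the lattice of `Λ`. The term `l = 0` of the sum is `1 / z`,
because `1 / 0 = 0`. -/
def zetaW (Λ : PeriodPair) (z : ℂ) : ℂ :=
  ∑' l : Λ.lattice, (1 / (z - (l : ℂ)) + 1 / (l : ℂ) + z / (l : ℂ) ^ 2)

/-- Weierstrass `σ`-function of the lattice of `Λ`. The factor `l = 0` of the product is `1`,
because `z / 0 = 0`. -/
def sigmaW (Λ : PeriodPair) (z : ℂ) : ℂ :=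
  z * ∏' l : Λ.lattice,
    ((1 - z / (l : ℂ)) * Complex.exp (z / (l : ℂ) + z ^ 2 / (2 * (l : ℂ) ^ 2)))

/-- The second half-period `w'`. -/
def halfPeriod' (Λ : PeriodPair) : ℂ := Λ.ω₂ / 2

/-- The shifted Lamé function `Ψ̃_X(k)`. -/
def lame (Λ : PeriodPair) (X : ℝ) (k : ℂ) : ℂ :=
  sigmaW Λ (X + k + halfPeriod' Λ) / (sigmaW Λ (X + halfPeriod' Λ) * sigmaW Λ k) *
    Complex.exp (-zetaW Λ k * X - zetaW Λ (halfPeriod' Λ) * k)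

/-- The shifted generalized Lamé function `Ψ̃_X(k, l)`. -/
def lame₂ (Λ : PeriodPair) (X : ℝ) (k l : ℂ) : ℂ :=
  sigmaW Λ (X + k + l + halfPeriod' Λ) / (sigmaW Λ (X + halfPeriod' Λ) * sigmaW Λ (k + l)) *
    Complex.exp (-(zetaW Λ k + zetaW Λ l) * X - zetaW Λ (halfPeriod' Λ) * (k + l))

/-- The data entering the integral equation: the contours `L j`, the measures
`dλ_j(l) = ρ_j(l) dm_j(l)` on them (`ρ_j` a complex density, so that `dλ_j` may be a complex
measure, for instance `dl / (2πi (l - k))` on a closed contour or a combination of point masses),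
the roots `ω_j(l) = root j l`, the coefficient functions `μ₀`, `γ₀`, and the set `K` of values of the
spectral parameter `k`. -/
structure SpectralData where
  K : Set ℂ
  L : Fin 2 → Set ℂ
  m : Fin 2 → Measure ℂ
  ρ : Fin 2 → ℂ → ℂ
  root : Fin 2 → ℂ → ℂ
  μ₀ : ℂ → ℂ
  γ₀ : ℂ → ℂ

namespace SpectralData

/-- The measures live on the contours, no `σ`, `ζ`, `℘` in the integral equation is
evaluated at a pole (or, in a denominator, at a zero), and `l`, `ω_1(l)`, `ω_2(l)` are distinct
modulo the period lattice and solve `2℘'(z) + b₀℘(z) = 2℘'(l) + b₀℘(l)`. -/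
structure IsAdmissible (S : SpectralData) (Λ : PeriodPair) (b₀ : ℝ) : Prop where
  contour_subset : ∀ j, S.L j ⊆ S.K
  measure_compl : ∀ j, S.m j (S.L j)ᶜ = 0
  notMem_lattice : ∀ k ∈ S.K, k ∉ Λ.lattice
  root_notMem_lattice : ∀ j, ∀ l ∈ S.L j, S.root j l ∉ Λ.lattice
  sub_root_notMem_lattice : ∀ k ∈ S.K, ∀ j, ∀ l ∈ S.L j, k - S.root j l ∉ Λ.lattice
  root_distinct : ∀ l ∈ S.L 0 ∩ S.L 1, S.root 0 l - S.root 1 l ∉ Λ.lattice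
  root_eq : ∀ j, ∀ l ∈ S.L j,
    2 * Λ.derivWeierstrassP (S.root j l) + b₀ * Λ.weierstrassP (S.root j l) =
      2 * Λ.derivWeierstrassP l + b₀ * Λ.weierstrassP l

/-- The data are real, i.e. invariant under complex conjugation. If `K`, `L j` are subsets
of the real line, this says exactly that `ω_j`, `μ₀(k)`, `γ₀(ω_j(l))`, `ρ_j` are real (and puts no
restriction on `m_j`). -/
structure IsReal (S : SpectralData) : Prop where
  conj_mem : ∀ k ∈ S.K, conj k ∈ S.K
  conj_mem_contour : ∀ j, ∀ l ∈ S.L j, conj l ∈ S.L j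
  measure_conj : ∀ j, (S.m j).map (fun l : ℂ => conj l) = S.m j
  density_conj : ∀ j, ∀ l ∈ S.L j, S.ρ j (conj l) = conj (S.ρ j l)
  root_conj : ∀ j, ∀ l ∈ S.L j, S.root j (conj l) = conj (S.root j l)
  mu_conj : ∀ k ∈ S.K, S.μ₀ (conj k) = conj (S.μ₀ k)
  gamma_conj : ∀ j, ∀ l ∈ S.L j, S.γ₀ (conj (S.root j l)) = conj (S.γ₀ (S.root j l))

/-- `μ_k(Y)`. -/
def mu (S : SpectralData) (Λ : PeriodPair) (Y : ℝ) (k : ℂ) : ℂ :=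
  S.μ₀ k * Complex.exp (Λ.weierstrassP k * Y)

/-- `γ_{-ω_j(l)}(Y)`. -/
def gamma (S : SpectralData) (Λ : PeriodPair) (j : Fin 2) (Y : ℝ) (l : ℂ) : ℂ :=
  S.γ₀ (S.root j l) * Complex.exp (-Λ.weierstrassP (S.root j l) * Y)

/-- Integrand (with respect to `m_j`) of the integral equation, for a function `φ` of the
spectral variable. -/
def eqIntegrand (S : SpectralData) (Λ : PeriodPair) (j : Fin 2) (k : ℂ) (X Y : ℝ)
    (φ : ℂ → ℂ) (l : ℂ) : ℂ :=
  φ l * S.gamma Λ j Y l * lame₂ Λ X k (-S.root j l) * S.ρ j l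

/-- Integrand (with respect to `m_j`) in the formula for `u`. -/
def potIntegrand (S : SpectralData) (Λ : PeriodPair) (j : Fin 2) (X Y : ℝ)
    (φ : ℂ → ℂ) (l : ℂ) : ℂ :=
  φ l * S.gamma Λ j Y l * lame Λ X (-S.root j l) * S.ρ j l

/-- `ψ` solves the linear integral equation. -/
def SolvesIntegralEq (S : SpectralData) (Λ : PeriodPair) (ψ : ℝ → ℝ → ℂ → ℂ) : Prop :=
  ∀ X Y : ℝ, ∀ k ∈ S.K,
    ψ X Y k + S.mu Λ Y k * ∑ j, ∫ l, S.eqIntegrand Λ j k X Y (ψ X Y) l ∂(S.m j) =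
      S.mu Λ Y k * lame Λ X k

/-- For all real `X`, `Y`, the homogeneous integral equation has only the zero solution (among
all functions of the spectral variable for which the integrals exist). -/
def HomogeneousUnique (S : SpectralData) (Λ : PeriodPair) : Prop :=
  ∀ (X Y : ℝ) (φ : ℂ → ℂ),
    (∀ k ∈ S.K, ∀ j, Integrable (S.eqIntegrand Λ j k X Y φ) (S.m j)) →
    (∀ k ∈ S.K,
      φ k + S.mu Λ Y k * ∑ j, ∫ l, S.eqIntegrand Λ j k X Y φ l ∂(S.m j) = 0) →
    ∀ k ∈ S.K, φ k = 0

end SpectralData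

/-- `∂_X^a ∂_Y^b G`. -/
def mixedDeriv (a b : ℕ) (G : ℝ → ℝ → ℂ) (X Y : ℝ) : ℂ :=
  iteratedDeriv a (fun x => iteratedDeriv b (fun y => G x y) Y) X

/-- Differentiation with respect to `X` and `Y`, to any order, commutes with the integral
`∫ G(X, Y; l) dm(l)`: the integrals of all partial derivatives of `G` exist, and the
integral of `∂_X^a ∂_Y^b G` is a differentiable function of `(X, Y)`, whose differential is
obtained by differentiating under the integral sign. -/
def DiffUnderIntegral (m : Measure ℂ) (G : ℝ → ℝ → ℂ → ℂ) : Prop :=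
  ∀ (a b : ℕ) (X Y : ℝ),
    Integrable (fun l => mixedDeriv a b (fun x y => G x y l) X Y) m ∧
    HasFDerivAt (𝕜 := ℝ)
      (fun p : ℝ × ℝ => ∫ l, mixedDeriv a b (fun x y => G x y l) p.1 p.2 ∂m)
      ((ContinuousLinearMap.fst ℝ ℝ ℝ).smulRight
          (∫ l, mixedDeriv (a + 1) b (fun x y => G x y l) X Y ∂m) +
        (ContinuousLinearMap.snd ℝ ℝ ℝ).smulRight
          (∫ l, mixedDeriv a (b + 1) (fun x y => G x y l) X Y ∂m))
      (X, Y)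

/-- Derivatives with respect to `X` and `Y` commute with the integrals in the integral equation
and in the formula for `u`. -/
def SpectralData.DerivativesCommute (S : SpectralData) (Λ : PeriodPair)
    (ψ : ℝ → ℝ → ℂ → ℂ) : Prop :=
  ∀ j, (∀ k ∈ S.K,
      DiffUnderIntegral (S.m j) (fun X Y l => S.eqIntegrand Λ j k X Y (ψ X Y) l)) ∧
    DiffUnderIntegral (S.m j) (fun X Y l => S.potIntegrand Λ j X Y (ψ X Y) l)

/-- `u(X, Y) = -2℘(X + w') - 2 ∂_X ∑_j ∫ ψ(X, Y; l) γ_{-ω_j(l)}(Y) Ψ̃_X(-ω_j(l)) dλ_j(l)`. -/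
def SpectralData.potential (S : SpectralData) (Λ : PeriodPair) (ψ : ℝ → ℝ → ℂ → ℂ)
    (X Y : ℝ) : ℂ :=
  -2 * Λ.weierstrassP (X + halfPeriod' Λ) -
    2 * deriv (fun x : ℝ => ∑ j, ∫ l, S.potIntegrand Λ j x Y (ψ x Y) l ∂(S.m j)) X

/-- `∂_X v`. -/
def dX (v : ℝ → ℝ → ℝ) (X Y : ℝ) : ℝ := deriv (fun x => v x Y) X

/-- `∂_Y v`. -/
def dY (v : ℝ → ℝ → ℝ) (X Y : ℝ) : ℝ := deriv (fun y => v X y) Y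

/-- `(b₀ v_Y + v_XXX + 6 v v_X)_X + 3 v_YY = 0` on `ℝ²`. -/
def SolvesExtendedBoussinesq (b₀ : ℝ) (v : ℝ → ℝ → ℝ) : Prop :=
  ∀ X Y : ℝ,
    dX (fun x y => b₀ * dY v x y + dX (dX (dX v)) x y + 6 * v x y * dX v x y) X Y +
      3 * dY (dY v) X Y = 0

end EllipticDL

end

/-!
The potential `u` belongs to the Lax pair
  `ψ_Y = ψ_XX + u ψ`,   `4 ψ_XXX + 6 u ψ_X + q ψ + b₀ ψ_Y = (2℘'(k) + b₀ ℘(k)) ψ`,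
with `q_X = 3 (u_Y + u_XX)`. If both equations hold, their compatibility says that `R ψ = 0` for the
function `R = q_Y - 3 u_XY + u_XXX + 6 u u_X + b₀ u_Y` (`SmoothFn.lax_compatibility`), and
`R = 0`, differentiated once in `X`, is the extended Boussinesq equation.

The Lax equations are obtained by direct linearization. The background wave `μ_k(Y) Ψ̃_X(k)` solves
the pair with `u = -2℘(X + w')`, `q = -6℘'(X + w')`. Applied to the integral equation, either
operator yields the homogeneous integral equation for the defect of `ψ`, which is zero by uniqueness
(`SmoothSolution.DY_f`, `SmoothSolution.thirdOrder_f`). Three properties of the kernel are used: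
  `∂_X Ψ̃(k, l) = -Ψ̃(k) Ψ̃(l)`,   `(℘(k) - ℘(l)) Ψ̃(k, l) = Ψ̃(k) Ψ̃'(l) - Ψ̃'(k) Ψ̃(l)`,
and a similar formula for `(℘'(k) + ℘'(l)) Ψ̃(k, l)` (`deriv_lame₂`, `weierstrassP_sub_mul_lame₂`,
`derivWeierstrassP_add_mul_lame₂`); by the first one, the `X`-derivatives of the integral equation
produce the integrals in the potential. In the third-order equation the integrand at `l` carries the
eigenvalue `2℘' + b₀ ℘` at `ω_j(l)`, and the equation for the root says that this is the eigenvalue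
at `l`. As `R ψ(·; k) = 0` for all `k`, `R` vanishes wherever some inhomogeneity `μ_k(Y) Ψ̃_X(k)`
does not. The zeros of the latter in `X` are countable unless all `μ₀(k)` vanish, in which case
`u = -2℘(X + w')` (`SmoothSolution.integrated_equation`).

The kernel formulas are consequences of one addition formula for `σ` and `ζ`
(`zetaW_add_add_sub`), which follows from Liouville's theorem, and of its derivatives. They are
proved off a countable set of `X` and extended by continuity.

Smoothness of `u` is contained in the hypothesis on differentiation under the integral sign,
together with the fact that `ℝ + w'` contains no period. For the reality of `u`, the complex
conjugate of `ψ(X, Y; k̄)` solves the same integral equation as `ψ(X, Y; k)`, so that they agree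
(`psi_conj`).
-/

noncomputable section
namespace EllipticDL

open Filter Topology

/-! ### The Weierstrass functions `σ` and `ζ` -/

/-- The Weierstrass primary factor of genus two is `1 + O(t³)`. -/
lemma norm_primaryFactor_sub_one_le {t : ℂ} (ht : ‖t‖ ≤ 1 / 2) :
    ‖(1 - t) * Complex.exp (t + t ^ 2 / 2) - 1‖ ≤ 20 * ‖t‖ ^ 3 := by
  set s := t + t ^ 2 / 2 with hs
  have hsn : ‖s‖ ≤ 5 / 4 * ‖t‖ := by
    calc ‖s‖ ≤ ‖t‖ + ‖t ^ 2 / 2‖ := norm_add_le _ _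
      _ = ‖t‖ + ‖t‖ ^ 2 / 2 := by simp
      _ ≤ 5 / 4 * ‖t‖ := by nlinarith [norm_nonneg t]
  have hexp := Complex.norm_exp_sub_sum_le_norm_mul_exp s 3
  simp only [Finset.sum_range_succ, Finset.range_zero, Finset.sum_empty, Nat.factorial] at hexp
  set R := Complex.exp s - (1 + s + s ^ 2 / 2) with hR
  have hRn : ‖R‖ ≤ 6 * ‖t‖ ^ 3 := by
    have h1 : ‖R‖ ≤ ‖s‖ ^ 3 * Real.exp ‖s‖ := by
      convert hexp using 2
      rw [hR]; norm_num
    have h2 : ‖s‖ ^ 3 ≤ 2 * ‖t‖ ^ 3 := by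
      calc ‖s‖ ^ 3 ≤ (5 / 4 * ‖t‖) ^ 3 := by gcongr
        _ = (5 / 4) ^ 3 * ‖t‖ ^ 3 := by ring
        _ ≤ 2 * ‖t‖ ^ 3 := by gcongr; norm_num
    have h3 : Real.exp ‖s‖ ≤ 3 := by
      have : Real.exp ‖s‖ ≤ Real.exp 1 := Real.exp_le_exp.mpr (by linarith)
      linarith [Real.exp_one_lt_d9]
    calc ‖R‖ ≤ ‖s‖ ^ 3 * Real.exp ‖s‖ := h1
      _ ≤ (2 * ‖t‖ ^ 3) * 3 := by gcongr
      _ = _ := by ring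
  have hid : (1 - t) * Complex.exp s - 1 =
      t ^ 3 * (-1 / 2 - 3 / 8 * t - t ^ 2 / 8) + (1 - t) * R := by
    rw [hR, hs]; ring
  rw [hid]
  have hA : ‖(-1 / 2 - 3 / 8 * t - t ^ 2 / 8 : ℂ)‖ ≤ 1 := by
    calc ‖(-1 / 2 - 3 / 8 * t - t ^ 2 / 8 : ℂ)‖
        ≤ ‖(-1 / 2 : ℂ)‖ + ‖3 / 8 * t‖ + ‖t ^ 2 / 8‖ :=
          (norm_sub_le _ _).trans (add_le_add_left (norm_sub_le _ _) _)
      _ = 1 / 2 + 3 / 8 * ‖t‖ + ‖t‖ ^ 2 / 8 := by norm_num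
      _ ≤ 1 := by nlinarith [norm_nonneg t]
  have hB : ‖1 - t‖ ≤ 2 := (norm_sub_le _ _).trans (by norm_num; linarith)
  calc _ ≤ ‖t ^ 3 * (-1 / 2 - 3 / 8 * t - t ^ 2 / 8)‖ + ‖(1 - t) * R‖ := norm_add_le _ _
    _ = ‖t‖ ^ 3 * ‖(-1 / 2 - 3 / 8 * t - t ^ 2 / 8 : ℂ)‖ + ‖1 - t‖ * ‖R‖ := by
        rw [norm_mul, norm_mul, norm_pow]
    _ ≤ ‖t‖ ^ 3 * 1 + 2 * (6 * ‖t‖ ^ 3) := by gcongr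
    _ ≤ 20 * ‖t‖ ^ 3 := by nlinarith [pow_nonneg (norm_nonneg t) 3]

variable (Λ : PeriodPair)

/-- The factor of the lattice point `l` in the product for `σ`. -/
def sigmaFactor (l z : ℂ) : ℂ := (1 - z / l) * Complex.exp (z / l + z ^ 2 / (2 * l ^ 2))

/-- The entire function `σ(z) / z`. -/
def sigmaProd (z : ℂ) : ℂ := ∏' l : Λ.lattice, sigmaFactor l z

lemma sigmaW_eq (z : ℂ) : sigmaW Λ z = z * sigmaProd Λ z := rfl

lemma eventually_two_mul_le_norm (r : ℝ) :
    ∀ᶠ l : Λ.lattice in cofinite, 2 * r ≤ ‖(l : ℂ)‖ := by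
  refine (isCompact_iff_finite.mp (isCompact_closedBall (0 : Λ.lattice) (2 * r))).subset ?_
  intro l hl
  have hl' : ‖(l : ℂ)‖ < 2 * r := by simpa using hl
  simpa using hl'.le

lemma summable_norm_lattice : Summable fun l : Λ.lattice ↦ ‖(l : ℂ)‖ ^ (-3 : ℝ) :=
  ZLattice.summable_norm_rpow _ _ (by simp; norm_num)

lemma norm_sigmaFactor_sub_one_le {r : ℝ} {z l : ℂ} (hr : 0 < r) (hz : ‖z‖ < r)
    (hl : 2 * r ≤ ‖l‖) : ‖sigmaFactor l z - 1‖ ≤ 20 * r ^ 3 * ‖l‖ ^ (-3 : ℝ) := by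
  have hl0 : 0 < ‖l‖ := by linarith
  have ht : ‖z / l‖ ≤ 1 / 2 := by
    rw [norm_div, div_le_iff₀ hl0]; linarith
  have h := norm_primaryFactor_sub_one_le ht
  have h1 : sigmaFactor l z = (1 - z / l) * Complex.exp (z / l + (z / l) ^ 2 / 2) := by
    rw [sigmaFactor]; congr 3; ring
  rw [h1]
  refine h.trans ?_
  have h2 : ‖l‖ ^ (-3 : ℝ) = (‖l‖ ^ 3)⁻¹ := by
    rw [Real.rpow_neg hl0.le]; norm_cast
  rw [h2, norm_div, div_pow, mul_assoc]
  gcongr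
  rw [div_eq_mul_inv]
  gcongr

lemma differentiable_sigmaFactor (l : ℂ) : Differentiable ℂ (sigmaFactor l) := by
  unfold sigmaFactor; fun_prop

lemma hasProdLocallyUniformlyOn_sigmaFactor {r : ℝ} (hr : 0 < r) :
    HasProdLocallyUniformlyOn (fun (l : Λ.lattice) z ↦ sigmaFactor l z) (sigmaProd Λ)
      (Metric.ball 0 r) := by
  have := Summable.hasProdLocallyUniformlyOn_one_add
    (f := fun (l : Λ.lattice) z ↦ sigmaFactor l z - 1)
    (K := Metric.ball (0 : ℂ) r) Metric.isOpen_ball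
    ((summable_norm_lattice Λ).mul_left (20 * r ^ 3)) ?_ ?_
  · simp only [add_sub_cancel] at this
    exact this
  · filter_upwards [eventually_two_mul_le_norm Λ r] with l hl z hz
    exact norm_sigmaFactor_sub_one_le hr (by simpa using hz) hl
  · intro l
    exact ((differentiable_sigmaFactor l).continuous.sub continuous_const).continuousOn

lemma differentiable_sigmaProd : Differentiable ℂ (sigmaProd Λ) := by
  intro z
  have h := (hasProdLocallyUniformlyOn_sigmaFactor Λ (r := ‖z‖ + 1) (by positivity))
  rw [hasProdLocallyUniformlyOn_iff_tendstoLocallyUniformlyOn] at h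
  refine (h.differentiableOn (.of_forall fun s ↦ ?_) Metric.isOpen_ball).differentiableAt
    (Metric.isOpen_ball.mem_nhds (by simp))
  exact DifferentiableOn.fun_finsetProd fun i _ ↦ (differentiable_sigmaFactor i).differentiableOn

lemma differentiable_sigmaW : Differentiable ℂ (sigmaW Λ) :=
  differentiable_id.mul (differentiable_sigmaProd Λ)

@[simp] lemma sigmaProd_zero : sigmaProd Λ 0 = 1 := by simp [sigmaProd, sigmaFactor]

@[simp] lemma sigmaW_zero : sigmaW Λ 0 = 0 := by simp [sigmaW_eq]

variable {Λ}

lemma sigmaFactor_ne_zero {z : ℂ} (hz : z ∉ Λ.lattice) (l : Λ.lattice) :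
    sigmaFactor l z ≠ 0 := by
  refine mul_ne_zero ?_ (Complex.exp_ne_zero _)
  intro h
  have h1 : z / l = 1 := (sub_eq_zero.mp h).symm
  have hl : (l : ℂ) ≠ 0 := by rintro hl; simp [hl] at h1
  rw [div_eq_one_iff_eq hl] at h1
  exact hz (h1 ▸ l.2)

lemma sigmaProd_ne_zero {z : ℂ} (hz : z ∉ Λ.lattice) : sigmaProd Λ z ≠ 0 := by
  have h := tprod_one_add_ne_zero_of_summable (f := fun l : Λ.lattice ↦ sigmaFactor l z - 1)
    (by simpa using fun l hl ↦ sigmaFactor_ne_zero hz ⟨l, hl⟩) ?_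
  · simpa only [add_sub_cancel, sigmaProd] using h
  · refine Summable.of_norm_bounded_eventually
      ((summable_norm_lattice Λ).mul_left (20 * (‖z‖ + 1) ^ 3)) ?_
    filter_upwards [eventually_two_mul_le_norm Λ (‖z‖ + 1)] with l hl
    rw [norm_norm]
    exact norm_sigmaFactor_sub_one_le (by positivity) (by linarith) hl

lemma ne_zero_of_notMem_lattice {z : ℂ} (hz : z ∉ Λ.lattice) : z ≠ 0 := by
  rintro rfl; exact hz (zero_mem _)

lemma sigmaW_ne_zero {z : ℂ} (hz : z ∉ Λ.lattice) : sigmaW Λ z ≠ 0 :=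
  mul_ne_zero (ne_zero_of_notMem_lattice hz) (sigmaProd_ne_zero hz)

lemma sub_ne_zero_of_notMem_lattice {z : ℂ} (hz : z ∉ Λ.lattice) (l : Λ.lattice) :
    z - l ≠ 0 := by
  intro h; exact hz (sub_eq_zero.mp h ▸ l.2)

lemma norm_zetaSummand_le {r : ℝ} (hr : 0 < r) {z l : ℂ} (hz : ‖z‖ < r) (hl : 2 * r ≤ ‖l‖) :
    ‖1 / (z - l) + 1 / l + z / l ^ 2‖ ≤ 2 * r ^ 2 * ‖l‖ ^ (-3 : ℝ) := by
  have hl0 : 0 < ‖l‖ := by linarith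
  have hlne : l ≠ 0 := norm_pos_iff.mp hl0
  have hzl : ‖l‖ / 2 ≤ ‖z - l‖ := by
    rw [norm_sub_rev]; exact le_trans (by linarith) (norm_sub_norm_le l z)
  have hzlne : z - l ≠ 0 := norm_pos_iff.mp (by linarith)
  have h2 : ‖l‖ ^ (-3 : ℝ) = (‖l‖ ^ 3)⁻¹ := by
    rw [Real.rpow_neg hl0.le]; norm_cast
  have h1 : 1 / (z - l) + 1 / l + z / l ^ 2 = z ^ 2 / (l ^ 2 * (z - l)) := by
    field_simp; ring
  rw [h1, h2, norm_div, norm_mul, norm_pow, norm_pow]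
  calc ‖z‖ ^ 2 / (‖l‖ ^ 2 * ‖z - l‖) ≤ r ^ 2 / (‖l‖ ^ 2 * (‖l‖ / 2)) := by gcongr
    _ = _ := by field_simp

variable (Λ) in
lemma hasSumLocallyUniformly_zetaW :
    HasSumLocallyUniformly
      (fun (l : Λ.lattice) (z : ℂ) ↦ 1 / (z - (l : ℂ)) + 1 / (l : ℂ) + z / (l : ℂ) ^ 2)
      (zetaW Λ) := by
  refine Λ.hasSumLocallyUniformly_aux (u := fun r l ↦ 2 * r ^ 2 * ‖(l : ℂ)‖ ^ (-3 : ℝ)) _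
    (fun _ _ ↦ (summable_norm_lattice Λ).mul_left _) fun r hr ↦
    Filter.eventually_atTop.mpr ⟨2 * r, ?_⟩
  rintro _ h z hz l rfl
  exact norm_zetaSummand_le hr hz h

lemma isOpen_compl_lattice : IsOpen ((Λ.lattice : Set ℂ)ᶜ) := Λ.isClosed_lattice.isOpen_compl

variable (Λ) in
lemma countable_lattice : (Λ.lattice : Set ℂ).Countable :=
  countable_of_Lindelof_of_discrete (X := Λ.lattice)

variable (Λ) in
lemma isPreconnected_compl_lattice : IsPreconnected ((Λ.lattice : Set ℂ)ᶜ) :=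
  ((countable_lattice Λ).isConnected_compl_of_one_lt_rank (by simp)).2

lemma hasDerivAt_zetaSummand {z l : ℂ} (h : z - l ≠ 0) :
    HasDerivAt (fun z : ℂ ↦ 1 / (z - l) + 1 / l + z / l ^ 2)
      (-(1 / (z - l) ^ 2 - 1 / l ^ 2)) z := by
  have h1 : HasDerivAt (fun z : ℂ ↦ 1 / (z - l)) (-1 / (z - l) ^ 2) z := by
    simpa using ((hasDerivAt_id' z).sub_const l).fun_inv h
  refine ((h1.add_const (1 / l)).fun_add ((hasDerivAt_id' z).div_const (l ^ 2))).congr_deriv ?_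
  ring

lemma differentiableOn_zetaSummand (l : Λ.lattice) :
    DifferentiableOn ℂ (fun z : ℂ ↦ 1 / (z - (l : ℂ)) + 1 / (l : ℂ) + z / (l : ℂ) ^ 2)
      ((Λ.lattice : Set ℂ)ᶜ) := fun _ hz ↦
  (hasDerivAt_zetaSummand
    (sub_ne_zero_of_notMem_lattice hz l)).differentiableAt.differentiableWithinAt

lemma hasDerivAt_zetaW {z : ℂ} (hz : z ∉ Λ.lattice) :
    HasDerivAt (zetaW Λ) (-Λ.weierstrassP z) z := by
  have hc := (hasSumLocallyUniformly_zetaW Λ).tendstoLocallyUniformlyOn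
    (s := (Λ.lattice : Set ℂ)ᶜ)
  have hd : ∀ s : Finset Λ.lattice, DifferentiableOn ℂ (fun z : ℂ ↦ ∑ l ∈ s,
      (1 / (z - (l : ℂ)) + 1 / (l : ℂ) + z / (l : ℂ) ^ 2)) ((Λ.lattice : Set ℂ)ᶜ) :=
    fun s ↦ .fun_sum fun l _ ↦ differentiableOn_zetaSummand l
  have h1 : DifferentiableAt ℂ (zetaW Λ) z :=
    (hc.differentiableOn (.of_forall hd) isOpen_compl_lattice).differentiableAt
      (isOpen_compl_lattice.mem_nhds hz)
  have h2 := (hc.deriv (.of_forall hd) isOpen_compl_lattice).tendsto_at hz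
  have h3 : HasSum (fun l : Λ.lattice ↦ -(1 / (z - (l : ℂ)) ^ 2 - 1 / (l : ℂ) ^ 2))
      (deriv (zetaW Λ) z) := by
    rw [HasSum]
    convert! h2 using 1
    ext1 s
    exact ((HasDerivAt.fun_sum fun (l : Λ.lattice) _ ↦ hasDerivAt_zetaSummand
      (sub_ne_zero_of_notMem_lattice hz l)).deriv).symm
  rw [← h3.unique (Λ.hasSum_weierstrassP z).neg]
  exact h1.hasDerivAt

lemma logDeriv_sigmaFactor {z l : ℂ} (hl : l ≠ 0) (hz : z - l ≠ 0) :
    logDeriv (sigmaFactor l) z = 1 / (z - l) + 1 / l + z / l ^ 2 := by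
  have h1 : HasDerivAt (fun z : ℂ ↦ 1 - z / l) (-(1 / l)) z := by
    simpa using ((hasDerivAt_id z).div_const l).const_sub 1
  have h2 : HasDerivAt (fun z : ℂ ↦ z / l + z ^ 2 / (2 * l ^ 2))
      (1 / l + 2 * z / (2 * l ^ 2)) z := by
    simpa using ((hasDerivAt_id' z).div_const l).fun_add
      ((hasDerivAt_pow 2 z).div_const (2 * l ^ 2))
  have h := (h1.mul h2.cexp).deriv
  have hne : 1 - z / l ≠ 0 := by
    intro h
    have h1 : z / l = 1 := (sub_eq_zero.mp h).symm
    rw [div_eq_one_iff_eq hl] at h1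
    exact hz (sub_eq_zero.mpr h1)
  have hne' : l - z ≠ 0 := by rwa [← neg_sub, neg_ne_zero]
  have hsf : sigmaFactor l =
      (fun z ↦ 1 - z / l) * (fun z ↦ Complex.exp (z / l + z ^ 2 / (2 * l ^ 2))) := rfl
  rw [logDeriv_apply, hsf, h, Pi.mul_apply]
  have he := Complex.exp_ne_zero (z / l + z ^ 2 / (2 * l ^ 2))
  generalize Complex.exp (z / l + z ^ 2 / (2 * l ^ 2)) = E at he ⊢
  rw [div_eq_iff (mul_ne_zero hne he)]
  field_simp
  ring

/-- The factor of `l = 0` in the product is `1`, whereas the term of `l = 0` in the sum for `ζ` is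
`1 / z`. -/
lemma logDeriv_sigmaProd {z : ℂ} (hz : z ∉ Λ.lattice) :
    logDeriv (sigmaProd Λ) z = zetaW Λ z - 1 / z := by
  have hsum : Summable
      fun l : Λ.lattice ↦ (1 / (z - (l : ℂ)) + 1 / (l : ℂ) + z / (l : ℂ) ^ 2) :=
    (hasSumLocallyUniformly_zetaW Λ).hasSum.summable
  have hterm : ∀ l : Λ.lattice, logDeriv (sigmaFactor l) z =
      if l = 0 then 0 else (1 / (z - (l : ℂ)) + 1 / (l : ℂ) + z / (l : ℂ) ^ 2) := by
    intro l
    split_ifs with h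
    · have : sigmaFactor (l : ℂ) = fun _ ↦ 1 := by ext w; simp [sigmaFactor, h]
      rw [this]; simp
    · exact logDeriv_sigmaFactor (by simpa using h) (sub_ne_zero_of_notMem_lattice hz l)
  have hsum' : Summable fun l : Λ.lattice ↦
      if l = 0 then 0 else (1 / (z - (l : ℂ)) + 1 / (l : ℂ) + z / (l : ℂ) ^ 2) := by
    classical
    convert! hsum.update 0 0 using 1
    ext l
    by_cases h : l = 0
    · simp [h]
    · simp only [h, if_false, ne_eq, not_false_eq_true, Function.update_of_ne]
  have h := logDeriv_tprod_eq_tsum (f := fun (l : Λ.lattice) z ↦ sigmaFactor l z)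
    (s := Metric.ball 0 (‖z‖ + 1)) Metric.isOpen_ball (x := z) (by simp)
    (sigmaFactor_ne_zero hz) (fun l ↦ (differentiable_sigmaFactor l).differentiableOn)
    (by simpa only [hterm] using hsum')
    (hasProdLocallyUniformlyOn_sigmaFactor Λ (by positivity)).multipliableLocallyUniformlyOn
    (sigmaProd_ne_zero hz)
  have h' : logDeriv (sigmaProd Λ) z = ∑' l : Λ.lattice, logDeriv (sigmaFactor l) z := h
  classical
  rw [h', zetaW, hsum.tsum_eq_add_tsum_ite 0]
  simp only [hterm]
  simp

lemma hasDerivAt_sigmaW {z : ℂ} (hz : z ∉ Λ.lattice) :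
    HasDerivAt (sigmaW Λ) (sigmaW Λ z * zetaW Λ z) z := by
  have h := (hasDerivAt_id z).mul (differentiable_sigmaProd Λ z).hasDerivAt
  have h0 := ne_zero_of_notMem_lattice hz
  have h1 := logDeriv_sigmaProd hz
  rw [logDeriv_apply, div_eq_iff (sigmaProd_ne_zero hz)] at h1
  refine HasDerivAt.congr_deriv (f := sigmaW Λ) h ?_
  rw [sigmaW_eq, h1, id]
  field_simp
  ring

lemma deriv_sigmaW_zero : HasDerivAt (sigmaW Λ) 1 0 := by
  refine HasDerivAt.congr_deriv (f := sigmaW Λ)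
    ((hasDerivAt_id (0 : ℂ)).mul (differentiable_sigmaProd Λ 0).hasDerivAt) ?_
  simp

@[simp] lemma zetaW_neg (z : ℂ) : zetaW Λ (-z) = -zetaW Λ z := by
  simp only [zetaW]
  rw [← (Equiv.neg Λ.lattice).tsum_eq, ← tsum_neg]
  congr with l
  have : (-z - -(l : ℂ)) = -(z - l) := by ring
  simp only [Equiv.neg_apply, Submodule.coe_neg, this, div_neg, neg_sq, neg_div]
  ring

@[simp] lemma sigmaW_neg (z : ℂ) : sigmaW Λ (-z) = -sigmaW Λ z := by
  rw [sigmaW_eq, sigmaW_eq, sigmaProd, sigmaProd, ← (Equiv.neg Λ.lattice).tprod_eq, neg_mul]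
  congr 3 with l
  simp [sigmaFactor]

lemma add_notMem_lattice {z l : ℂ} (hz : z ∉ Λ.lattice) (hl : l ∈ Λ.lattice) :
    z + l ∉ Λ.lattice := fun h ↦ hz (by simpa using sub_mem h hl)

lemma neg_notMem_lattice {z : ℂ} (hz : z ∉ Λ.lattice) : -z ∉ Λ.lattice :=
  fun h ↦ hz (by simpa using neg_mem h)

/-- Quasi-periodicity of `ζ`. -/
lemma exists_zetaW_add (l : Λ.lattice) :
    ∃ η : ℂ, ∀ z ∉ Λ.lattice, zetaW Λ (z + l) = zetaW Λ z + η := by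
  have hz₀ := Λ.ω₁_div_two_notMem_lattice
  refine ⟨zetaW Λ (Λ.ω₁ / 2 + l) - zetaW Λ (Λ.ω₁ / 2), fun z hz ↦ ?_⟩
  have hd : ∀ z ∉ Λ.lattice, HasDerivAt (fun z ↦ zetaW Λ (z + l)) (-Λ.weierstrassP z) z := by
    intro z hz
    simpa using (hasDerivAt_zetaW (add_notMem_lattice hz l.2)).comp_add_const z (l : ℂ)
  have h := isOpen_compl_lattice.eqOn_of_deriv_eq (𝕜 := ℂ) (isPreconnected_compl_lattice Λ)
    (f := fun z ↦ zetaW Λ (z + l))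
    (g := fun z ↦ zetaW Λ z + (zetaW Λ (Λ.ω₁ / 2 + l) - zetaW Λ (Λ.ω₁ / 2)))
    (fun z hz ↦ (hd z hz).differentiableAt.differentiableWithinAt)
    (fun z hz ↦ ((hasDerivAt_zetaW hz).add_const _).differentiableAt.differentiableWithinAt)
    (fun z hz ↦ by rw [(hd z hz).deriv, ((hasDerivAt_zetaW hz).add_const _).deriv])
    (x := Λ.ω₁ / 2) hz₀ (by ring)
  exact h hz

/-- Quasi-periodicity of `σ`, together with that of `ζ`. -/
lemma exists_sigmaW_add (l : Λ.lattice) :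
    ∃ η C : ℂ, (∀ z ∉ Λ.lattice, zetaW Λ (z + l) = zetaW Λ z + η) ∧ C ≠ 0 ∧
      ∀ z, sigmaW Λ (z + l) = sigmaW Λ z * (C * Complex.exp (η * z)) := by
  obtain ⟨η, hη⟩ := exists_zetaW_add l
  set z₀ := Λ.ω₁ / 2
  have hz₀ : z₀ ∉ Λ.lattice := Λ.ω₁_div_two_notMem_lattice
  set q : ℂ → ℂ := fun z ↦ sigmaW Λ (z + l) * Complex.exp (-(η * z)) / sigmaW Λ z with hq
  have hd : ∀ z ∉ Λ.lattice, HasDerivAt q 0 z := by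
    intro z hz
    have h1 := (hasDerivAt_sigmaW (add_notMem_lattice hz l.2)).comp_add_const z (l : ℂ)
    have h2 : HasDerivAt (fun z ↦ Complex.exp (-(η * z))) (Complex.exp (-(η * z)) * -(η * 1)) z :=
      ((hasDerivAt_id z).const_mul η).neg.cexp
    have h3 := (h1.mul h2).div (hasDerivAt_sigmaW hz) (sigmaW_ne_zero hz)
    refine h3.congr_deriv ?_
    rw [div_eq_zero_iff, hη z hz, Pi.mul_apply]
    left; ring
  have hconst : ∀ z ∉ Λ.lattice, q z = q z₀ := by
    intro z hz
    exact isOpen_compl_lattice.eqOn_of_deriv_eq (𝕜 := ℂ) (isPreconnected_compl_lattice Λ)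
      (f := q) (g := fun _ ↦ q z₀)
      (fun z hz ↦ (hd z hz).differentiableAt.differentiableWithinAt)
      (differentiableOn_const _) (fun z hz ↦ by rw [(hd z hz).deriv, deriv_const])
      hz₀ rfl hz
  have hC : q z₀ ≠ 0 := div_ne_zero
    (mul_ne_zero (sigmaW_ne_zero (add_notMem_lattice hz₀ l.2)) (Complex.exp_ne_zero _))
    (sigmaW_ne_zero hz₀)
  refine ⟨η, q z₀, hη, hC, fun z ↦ ?_⟩
  have hdense : Dense ((Λ.lattice : Set ℂ)ᶜ) :=
    (countable_lattice Λ).dense_compl ℝ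
  refine congrFun (Continuous.ext_on hdense (f := fun z ↦ sigmaW Λ (z + l))
    (g := fun z ↦ sigmaW Λ z * (q z₀ * Complex.exp (η * z))) ?_ ?_ fun z hz ↦ ?_) z
  · exact (differentiable_sigmaW Λ).continuous.comp (by fun_prop)
  · exact (differentiable_sigmaW Λ).continuous.mul (by fun_prop)
  · simp only
    rw [← hconst z hz, hq]
    have := sigmaW_ne_zero hz
    simp only [Complex.exp_neg]
    have he := Complex.exp_ne_zero (η * z)
    field_simp

end EllipticDL
end

noncomputable section
namespace EllipticDL

open Filter Topology

variable {Λ : PeriodPair}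

/-! ### Elliptic functions without poles, and the addition formulas -/

/-- `f` has a removable singularity at `z` (no condition on the value `f z`). -/
def RemovableAt (f : ℂ → ℂ) (z : ℂ) : Prop := ∃ g : ℂ → ℂ, AnalyticAt ℂ g z ∧ f =ᶠ[𝓝[≠] z] g

lemma RemovableAt.of_affine {f : ℂ → ℂ} {α β z : ℂ} (hα : α ≠ 0)
    (h : RemovableAt f (α * z + β)) (hf : ∀ᶠ w in 𝓝[≠] z, f (α * w + β) = f w) :
    RemovableAt f z := by
  obtain ⟨g, hg, hfg⟩ := h
  refine ⟨fun w ↦ g (α * w + β), hg.comp (f := fun w ↦ α * w + β) (by fun_prop), ?_⟩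
  have ht : Tendsto (fun w ↦ α * w + β) (𝓝[≠] z) (𝓝[≠] (α * z + β)) := by
    refine tendsto_nhdsWithin_iff.mpr ⟨?_, ?_⟩
    · exact (Continuous.tendsto (by fun_prop) z).mono_left nhdsWithin_le_nhds
    · filter_upwards [self_mem_nhdsWithin] with w hw
      intro h
      have h' : α * w = α * z := add_right_cancel h
      exact hw (mul_left_cancel₀ hα h')
  filter_upwards [hf, ht.eventually hfg] with w h1 h2
  rw [← h1, h2]

/-- Liouville's theorem for elliptic functions: an elliptic function with only removable
singularities is constant. -/
theorem eq_const_of_periodic_of_removableAt {f : ℂ → ℂ}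
    (hper : ∀ l ∈ Λ.lattice, ∀ z, ∀ᶠ w in 𝓝[≠] z, f (w + l) = f w)
    (hloc : ∀ z, RemovableAt f z) : ∃ c, ∀ z, ContinuousAt f z → f z = c := by
  -- `F` is `f` with its singularities removed
  set F : ℂ → ℂ := fun z ↦ limUnder (𝓝[≠] z) f with hF
  have key : ∀ z g, ContinuousAt g z → f =ᶠ[𝓝[≠] z] g → F z = g z := by
    intro z g hg h
    exact ((hg.tendsto.mono_left nhdsWithin_le_nhds).congr' h.symm).limUnder_eq
  have hFd : Differentiable ℂ F := by
    intro z
    obtain ⟨g, hg, hfg⟩ := hloc z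
    have : F =ᶠ[𝓝 z] g := by
      have h1 : ∀ᶠ w in 𝓝[≠] z, ∀ᶠ y in 𝓝[≠] w, f y = g y := by
        have h2 := eventually_eventually_nhdsWithin.mpr hfg
        filter_upwards [h2, self_mem_nhdsWithin] with w hw hwz
        have hw' : ∀ᶠ y in 𝓝 w, y ≠ z → f y = g y := eventually_nhdsWithin_iff.mp hw
        have hne : ∀ᶠ y in 𝓝 w, y ≠ z := isOpen_ne.mem_nhds hwz
        exact ((hw'.and hne).mono fun y hy ↦ hy.1 hy.2).filter_mono nhdsWithin_le_nhds
      have h3 : ∀ᶠ w in 𝓝[≠] z, F w = g w := by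
        filter_upwards [h1, hg.eventually_analyticAt.filter_mono nhdsWithin_le_nhds] with w hw hgw
        exact key w g hgw.continuousAt hw
      have h4 : F z = g z := key z g hg.continuousAt hfg
      filter_upwards [eventually_nhdsWithin_iff.mp h3] with w hw
      by_cases hwz : w = z
      · rw [hwz, h4]
      · exact hw hwz
    exact (hg.differentiableAt).congr_of_eventuallyEq this
  have hFper : ∀ z, ∀ l ∈ Λ.lattice, F (z + l) = F z := by
    intro z l hl
    have h1 : Tendsto (fun w ↦ w + l) (𝓝[≠] z) (𝓝[≠] (z + l)) := by
      refine tendsto_nhdsWithin_iff.mpr ⟨?_, ?_⟩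
      · exact (Continuous.tendsto (by fun_prop) z).mono_left nhdsWithin_le_nhds
      · filter_upwards [self_mem_nhdsWithin] with w hw h
        exact hw (add_right_cancel h)
    obtain ⟨g, hg, hfg⟩ := hloc (z + l)
    rw [key (z + l) g hg.continuousAt hfg]
    refine (key z (fun w ↦ g (w + l)) (ContinuousAt.comp (f := fun w ↦ w + l)
      hg.continuousAt (by fun_prop)) ?_).symm
    filter_upwards [h1.eventually hfg, hper l hl z] with w h2 h3
    rw [← h3, h2]
  have hconst := fun z ↦ hFd.apply_eq_apply_of_bounded
    (IsZLattice.isCompact_range_of_periodic Λ.lattice F hFd.continuous hFper).isBounded z 0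
  refine ⟨F 0, fun z hz ↦ ?_⟩
  rw [← hconst z]
  exact (key z f hz .rfl).symm

lemma eventually_notMem_lattice (z c : ℂ) : ∀ᶠ w in 𝓝[≠] z, w + c ∉ Λ.lattice := by
  have h := Λ.compl_lattice_sdiff_singleton_mem_nhds (z + c)
  have h1 : Tendsto (fun w ↦ w + c) (𝓝[≠] z) (𝓝 (z + c)) :=
    (Continuous.tendsto (by fun_prop) z).mono_left nhdsWithin_le_nhds
  filter_upwards [h1.eventually h, self_mem_nhdsWithin] with w hw hne hmem
  exact hw ⟨hmem, fun h ↦ hne (add_right_cancel h)⟩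

lemma analyticAt_sigmaW (z : ℂ) : AnalyticAt ℂ (sigmaW Λ) z :=
  (differentiable_sigmaW Λ).analyticAt z

lemma analyticAt_zetaW {z : ℂ} (hz : z ∉ Λ.lattice) : AnalyticAt ℂ (zetaW Λ) z :=
  DifferentiableOn.analyticAt (s := (Λ.lattice : Set ℂ)ᶜ)
    (fun _ hw ↦ (hasDerivAt_zetaW hw).differentiableAt.differentiableWithinAt)
    (isOpen_compl_lattice.mem_nhds hz)

variable (Λ) in
/-- The difference of the two sides of the addition formula `zetaW_add_add_sub`, as a function
of `a`. -/
def zetaDefect (b c a : ℂ) : ℂ :=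
  zetaW Λ a + zetaW Λ b + zetaW Λ c - zetaW Λ (a + (b + c)) -
    sigmaW Λ (a + b) * sigmaW Λ (b + c) * sigmaW Λ (a + c) /
      (sigmaW Λ a * sigmaW Λ b * sigmaW Λ c * sigmaW Λ (a + (b + c)))

lemma zetaDefect_add {b c a l : ℂ} (hl : l ∈ Λ.lattice) (ha : a ∉ Λ.lattice)
    (habc : a + (b + c) ∉ Λ.lattice) : zetaDefect Λ b c (a + l) = zetaDefect Λ b c a := by
  obtain ⟨η, C, hη, hC, hσ⟩ := exists_sigmaW_add ⟨l, hl⟩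
  simp only at hη hσ
  have e : ∀ d, a + l + d = a + d + l := fun d ↦ by ring
  simp only [zetaDefect, e, hη a ha, hη _ habc, hσ]
  have h1 : Complex.exp (η * (a + b)) = Complex.exp (η * a) * Complex.exp (η * b) := by
    rw [← Complex.exp_add]; ring_nf
  have h2 : Complex.exp (η * (a + c)) = Complex.exp (η * a) * Complex.exp (η * c) := by
    rw [← Complex.exp_add]; ring_nf
  have h3 : Complex.exp (η * (a + (b + c))) =
      Complex.exp (η * a) * Complex.exp (η * b) * Complex.exp (η * c) := by
    rw [← Complex.exp_add, ← Complex.exp_add]; ring_nf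
  rw [h1, h2, h3]
  set E := C ^ 2 * (Complex.exp (η * a) ^ 2 * Complex.exp (η * b) * Complex.exp (η * c)) with hE
  have hE0 : E ≠ 0 := by simp [hE, hC]
  have hnum : sigmaW Λ (a + b) * (C * (Complex.exp (η * a) * Complex.exp (η * b))) *
      sigmaW Λ (b + c) * (sigmaW Λ (a + c) * (C * (Complex.exp (η * a) * Complex.exp (η * c)))) =
      (sigmaW Λ (a + b) * sigmaW Λ (b + c) * sigmaW Λ (a + c)) * E := by rw [hE]; ring
  have hden : sigmaW Λ a * (C * Complex.exp (η * a)) * sigmaW Λ b * sigmaW Λ c *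
      (sigmaW Λ (a + (b + c)) * (C * (Complex.exp (η * a) * Complex.exp (η * b) *
        Complex.exp (η * c)))) =
      (sigmaW Λ a * sigmaW Λ b * sigmaW Λ c * sigmaW Λ (a + (b + c))) * E := by rw [hE]; ring
  rw [hnum, hden, mul_div_mul_right _ _ hE0]
  ring

lemma zetaDefect_reflect (b c a : ℂ) :
    zetaDefect Λ b c (-1 * a + -(b + c)) = zetaDefect Λ b c a := by
  have e1 : -1 * a + -(b + c) = -(a + (b + c)) := by ring
  have e2 : -(a + (b + c)) + (b + c) = -a := by ring
  have e3 : -(a + (b + c)) + b = -(a + c) := by ring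
  have e4 : -(a + (b + c)) + c = -(a + b) := by ring
  simp only [zetaDefect, e1, e2, e3, e4, zetaW_neg, sigmaW_neg]
  have : -sigmaW Λ (a + c) * sigmaW Λ (b + c) * -sigmaW Λ (a + b) /
      (-sigmaW Λ (a + (b + c)) * sigmaW Λ b * sigmaW Λ c * -sigmaW Λ a) =
      sigmaW Λ (a + b) * sigmaW Λ (b + c) * sigmaW Λ (a + c) /
      (sigmaW Λ a * sigmaW Λ b * sigmaW Λ c * sigmaW Λ (a + (b + c))) := by
    congr 1 <;> ring
  rw [this]
  ring

lemma analyticAt_zetaDefect {b c a : ℂ} (ha : a ∉ Λ.lattice) (hb : b ∉ Λ.lattice)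
    (hc : c ∉ Λ.lattice) (habc : a + (b + c) ∉ Λ.lattice) :
    AnalyticAt ℂ (zetaDefect Λ b c) a := by
  have hz : AnalyticAt ℂ (fun a ↦ zetaW Λ (a + (b + c))) a :=
    (analyticAt_zetaW habc).comp (f := fun a ↦ a + (b + c)) (by fun_prop)
  have hs : ∀ d, AnalyticAt ℂ (fun a ↦ sigmaW Λ (a + d)) a := fun d ↦
    (analyticAt_sigmaW _).comp (f := fun a ↦ a + d) (by fun_prop)
  have h0 := analyticAt_sigmaW (Λ := Λ) a
  have hz0 := analyticAt_zetaW ha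
  have h1 := hs b
  have h2 := hs c
  have h3 := hs (b + c)
  unfold zetaDefect
  refine AnalyticAt.sub (by fun_prop) (AnalyticAt.div (by fun_prop) (by fun_prop) ?_)
  simp [sigmaW_ne_zero, *]

lemma removableAt_zetaDefect_zero {b c : ℂ} (hb : b ∉ Λ.lattice)
    (hc : c ∉ Λ.lattice) (hbc : b + c ∉ Λ.lattice) : RemovableAt (zetaDefect Λ b c) 0 := by
  have hs : ∀ d, AnalyticAt ℂ (fun a ↦ sigmaW Λ (a + d)) 0 := fun d ↦
    (analyticAt_sigmaW _).comp (f := fun a ↦ a + d) (by fun_prop)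
  have hz : AnalyticAt ℂ (fun a ↦ zetaW Λ (a + (b + c))) 0 :=
    (analyticAt_zetaW (by simpa using hbc)).comp (f := fun a ↦ a + (b + c)) (by fun_prop)
  have hτ : AnalyticAt ℂ (sigmaProd Λ) 0 := (differentiable_sigmaProd Λ).analyticAt 0
  have h1 := hs b
  have h2 := hs c
  have h3 := hs (b + c)
  -- near `0` the quotient of `σ`s is `A(a) / a` with `A(0) = 1`, which cancels the pole of `ζ`
  set A : ℂ → ℂ := fun a ↦ sigmaW Λ (a + b) * sigmaW Λ (b + c) * sigmaW Λ (a + c) /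
      (sigmaProd Λ a * sigmaW Λ b * sigmaW Λ c * sigmaW Λ (a + (b + c))) with hA
  have hb' := sigmaW_ne_zero hb
  have hc' := sigmaW_ne_zero hc
  have hbc' := sigmaW_ne_zero hbc
  have hAan : AnalyticAt ℂ A 0 := by
    refine AnalyticAt.div (by fun_prop) (by fun_prop) ?_
    simp [*]
  have hA0 : A 0 = 1 := by
    simp only [hA, zero_add, sigmaProd_zero]
    field_simp
  obtain ⟨q, hq⟩ := hAan
  have hslope : AnalyticAt ℂ (dslope A 0) 0 := hq.has_fpower_series_dslope_fslope.analyticAt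
  refine ⟨fun a ↦ logDeriv (sigmaProd Λ) a + zetaW Λ b + zetaW Λ c - zetaW Λ (a + (b + c)) -
    dslope A 0 a, ?_, ?_⟩
  · have hlog : AnalyticAt ℂ (logDeriv (sigmaProd Λ)) 0 := by
      unfold logDeriv
      exact hτ.deriv.div hτ (by simp)
    fun_prop
  · filter_upwards [eventually_notMem_lattice (Λ := Λ) 0 0, self_mem_nhdsWithin] with a ha ha0
    rw [add_zero] at ha
    have ha0' : a ≠ 0 := ha0
    rw [logDeriv_sigmaProd ha, dslope_of_ne _ ha0', slope_def_field, hA0, sub_zero]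
    have hdiv : sigmaW Λ (a + b) * sigmaW Λ (b + c) * sigmaW Λ (a + c) /
      (sigmaW Λ a * sigmaW Λ b * sigmaW Λ c * sigmaW Λ (a + (b + c))) = A a / a := by
      rw [hA, sigmaW_eq Λ a, div_div]
      congr 1
      ring
    rw [zetaDefect, hdiv]
    ring

/-- The addition formula
`ζ(a) + ζ(b) + ζ(c) - ζ(a + b + c) = σ(a+b) σ(b+c) σ(a+c) / (σ(a) σ(b) σ(c) σ(a+b+c))`. Both
sides are elliptic in `a` with the same simple poles and residues, and agree at `a = -b`. -/
theorem zetaW_add_add_sub {a b c : ℂ} (ha : a ∉ Λ.lattice) (hb : b ∉ Λ.lattice)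
    (hc : c ∉ Λ.lattice) (hbc : b + c ∉ Λ.lattice) (habc : a + (b + c) ∉ Λ.lattice) :
    zetaW Λ a + zetaW Λ b + zetaW Λ c - zetaW Λ (a + (b + c)) =
      sigmaW Λ (a + b) * sigmaW Λ (b + c) * sigmaW Λ (a + c) /
        (sigmaW Λ a * sigmaW Λ b * sigmaW Λ c * sigmaW Λ (a + (b + c))) := by
  have hper : ∀ l ∈ Λ.lattice, ∀ z, ∀ᶠ w in 𝓝[≠] z,
      zetaDefect Λ b c (w + l) = zetaDefect Λ b c w := by
    intro l hl z
    filter_upwards [eventually_notMem_lattice (Λ := Λ) z 0,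
      eventually_notMem_lattice (Λ := Λ) z (b + c)] with w h1 h2
    exact zetaDefect_add hl (by simpa using h1) h2
  have hlat : ∀ z ∈ Λ.lattice, RemovableAt (zetaDefect Λ b c) z := by
    intro z hz
    refine RemovableAt.of_affine (α := 1) (β := -z) one_ne_zero ?_ ?_
    · simpa using removableAt_zetaDefect_zero hb hc hbc
    · simpa using hper (-z) (neg_mem hz) z
  have hloc : ∀ z, RemovableAt (zetaDefect Λ b c) z := by
    intro z
    by_cases hz : z ∈ Λ.lattice
    · exact hlat z hz
    by_cases hz' : z + (b + c) ∈ Λ.lattice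
    · refine RemovableAt.of_affine (α := -1) (β := -(b + c)) (by norm_num) (hlat _ ?_) ?_
      · have := neg_mem hz'
        rwa [neg_add, ← neg_one_mul z] at this
      · exact .of_forall fun w ↦ zetaDefect_reflect b c w
    · exact ⟨_, analyticAt_zetaDefect hz hb hc hz', .rfl⟩
  obtain ⟨C, hC⟩ := eq_const_of_periodic_of_removableAt hper hloc
  have h1 := hC a (analyticAt_zetaDefect ha hb hc habc).continuousAt
  have h2 := hC (-b) (analyticAt_zetaDefect (neg_notMem_lattice hb) hb hc
    (by simpa using hc)).continuousAt
  have h3 : zetaDefect Λ b c (-b) = 0 := by simp [zetaDefect]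
  rw [← h2, h3] at h1
  exact sub_eq_zero.mp h1

lemma hasDerivAt_weierstrassP {z : ℂ} (hz : z ∉ Λ.lattice) :
    HasDerivAt Λ.weierstrassP (Λ.derivWeierstrassP z) z := by
  rw [← Λ.deriv_weierstrassP]
  exact (Λ.analyticOnNhd_weierstrassP z hz).differentiableAt.hasDerivAt

lemma eventually_nhds_notMem_lattice {z : ℂ} (hz : z ∉ Λ.lattice) :
    ∀ᶠ w in 𝓝 z, w ∉ Λ.lattice := isOpen_compl_lattice.mem_nhds hz

lemma eventually_add_notMem_lattice {z c : ℂ} (hz : z + c ∉ Λ.lattice) :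
    ∀ᶠ w in 𝓝 z, w + c ∉ Λ.lattice :=
  (Continuous.tendsto (f := fun w : ℂ ↦ w + c) (by fun_prop) z).eventually
    (eventually_nhds_notMem_lattice hz)

/-- `℘(c) - ℘(b) = -σ(b+c) σ(c-b) / (σ(b)² σ(c)²)`: the derivative of `zetaW_add_add_sub` at
`a = -b`, where the right-hand side of that formula has a zero. -/
theorem weierstrassP_sub {b c : ℂ} (hb : b ∉ Λ.lattice) (hc : c ∉ Λ.lattice)
    (hbc : b + c ∉ Λ.lattice) :
    Λ.weierstrassP c - Λ.weierstrassP b =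
      -(sigmaW Λ (b + c) * sigmaW Λ (c - b)) / (sigmaW Λ b ^ 2 * sigmaW Λ c ^ 2) := by
  have hnb := neg_notMem_lattice hb
  have hnbc : -b + (b + c) ∉ Λ.lattice := by simpa using hc
  have h1 : HasDerivAt (fun a ↦ zetaW Λ a + zetaW Λ b + zetaW Λ c - zetaW Λ (a + (b + c)))
      (-Λ.weierstrassP b + Λ.weierstrassP c) (-b) := by
    refine ((((hasDerivAt_zetaW hnb).add_const _).add_const _).fun_sub
      ((hasDerivAt_zetaW hnbc).comp_add_const (-b) (b + c))).congr_deriv ?_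
    simp
  have hσ : ∀ d : ℂ, DifferentiableAt ℂ (fun a ↦ sigmaW Λ (a + d)) (-b) := fun d ↦
    DifferentiableAt.comp (-b) (g := sigmaW Λ) (f := fun a ↦ a + d)
      (differentiable_sigmaW Λ _) (by fun_prop)
  have hσ0 : DifferentiableAt ℂ (sigmaW Λ) (-b) := differentiable_sigmaW Λ _
  have hden : sigmaW Λ (-b) * sigmaW Λ b * sigmaW Λ c * sigmaW Λ (-b + (b + c)) ≠ 0 :=
    mul_ne_zero (mul_ne_zero (mul_ne_zero (sigmaW_ne_zero hnb) (sigmaW_ne_zero hb))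
      (sigmaW_ne_zero hc)) (sigmaW_ne_zero hnbc)
  have hM : DifferentiableAt ℂ (fun a ↦ sigmaW Λ (b + c) * sigmaW Λ (a + c) /
      (sigmaW Λ a * sigmaW Λ b * sigmaW Λ c * sigmaW Λ (a + (b + c)))) (-b) := by
    have h1 := hσ c
    have h2 := hσ (b + c)
    exact DifferentiableAt.fun_div (by fun_prop) (by fun_prop) hden
  have h2 : HasDerivAt (fun a ↦ sigmaW Λ (a + b)) 1 (-b) := by
    have : HasDerivAt (sigmaW Λ) 1 (-b + b) := by simpa using deriv_sigmaW_zero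
    exact this.comp_add_const (-b) b
  have h3 := h2.fun_mul hM.hasDerivAt
  have heq : (fun a ↦ zetaW Λ a + zetaW Λ b + zetaW Λ c - zetaW Λ (a + (b + c))) =ᶠ[𝓝 (-b)]
      fun a ↦ sigmaW Λ (a + b) * (sigmaW Λ (b + c) * sigmaW Λ (a + c) /
      (sigmaW Λ a * sigmaW Λ b * sigmaW Λ c * sigmaW Λ (a + (b + c)))) := by
    filter_upwards [eventually_nhds_notMem_lattice hnb, eventually_add_notMem_lattice hnbc]
      with a h4 h5
    rw [zetaW_add_add_sub h4 hb hc hbc h5]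
    ring
  have h4 := h1.unique (h3.congr_of_eventuallyEq heq)
  have e1 : -b + (b + c) = c := by ring
  have e2 : -b + c = c - b := by ring
  rw [neg_add_eq_sub, neg_add_cancel, sigmaW_zero, zero_mul, add_zero, one_mul, e1, e2,
    sigmaW_neg] at h4
  rw [h4]
  have := sigmaW_ne_zero hb
  have := sigmaW_ne_zero hc
  field_simp

lemma weierstrassP_sub_ne_zero {b c : ℂ} (hb : b ∉ Λ.lattice) (hc : c ∉ Λ.lattice)
    (hbc : b + c ∉ Λ.lattice) (hcb : c - b ∉ Λ.lattice) :
    Λ.weierstrassP c - Λ.weierstrassP b ≠ 0 := by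
  rw [weierstrassP_sub hb hc hbc]
  exact div_ne_zero (neg_ne_zero.mpr (mul_ne_zero (sigmaW_ne_zero hbc) (sigmaW_ne_zero hcb)))
    (mul_ne_zero (pow_ne_zero _ (sigmaW_ne_zero hb)) (pow_ne_zero _ (sigmaW_ne_zero hc)))

lemma hasDerivAt_sigmaW_add {z d : ℂ} (h : z + d ∉ Λ.lattice) :
    HasDerivAt (fun z ↦ sigmaW Λ (z + d)) (sigmaW Λ (z + d) * zetaW Λ (z + d)) z :=
  (hasDerivAt_sigmaW h).comp_add_const z d

/-- The logarithmic derivative of `weierstrassP_sub` in `c`. -/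
lemma derivWeierstrassP_eq_mul {b c : ℂ} (hb : b ∉ Λ.lattice) (hc : c ∉ Λ.lattice)
    (hbc : b + c ∉ Λ.lattice) (hcb : c - b ∉ Λ.lattice) :
    Λ.derivWeierstrassP c = (Λ.weierstrassP c - Λ.weierstrassP b) *
      (zetaW Λ (c + b) + zetaW Λ (c - b) - 2 * zetaW Λ c) := by
  have hb' := sigmaW_ne_zero hb
  have hc' := sigmaW_ne_zero hc
  have h1 := ((hasDerivAt_weierstrassP hc).sub_const (Λ.weierstrassP b))
  have hcb' : c + -b ∉ Λ.lattice := by rwa [← sub_eq_add_neg]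
  have hbc' : c + b ∉ Λ.lattice := by rwa [add_comm]
  have h2 := (((hasDerivAt_sigmaW_add hbc').fun_mul (hasDerivAt_sigmaW_add hcb')).fun_neg).fun_div
    (((hasDerivAt_sigmaW hc).fun_pow 2).const_mul (sigmaW Λ b ^ 2))
    (mul_ne_zero (pow_ne_zero 2 hb') (pow_ne_zero 2 hc'))
  have h3 := h1.unique (h2.congr_of_eventuallyEq ?_)
  · rw [weierstrassP_sub hb hc hbc, h3]
    simp only [← sub_eq_add_neg, add_comm b c]
    field_simp
    ring
  · filter_upwards [eventually_nhds_notMem_lattice hc, eventually_add_notMem_lattice hbc']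
      with w h4 h5
    rw [weierstrassP_sub hb h4 (by rwa [add_comm]), add_comm b w, sub_eq_add_neg w b]

/-- The addition formula for `ζ` with two arguments, with denominators cleared. -/
theorem two_mul_weierstrassP_sub_mul_zetaW {x k : ℂ} (hx : x ∉ Λ.lattice) (hk : k ∉ Λ.lattice)
    (hxk : x + k ∉ Λ.lattice) (hxk' : x - k ∉ Λ.lattice) :
    2 * (Λ.weierstrassP x - Λ.weierstrassP k) * (zetaW Λ (x + k) - zetaW Λ x - zetaW Λ k) =
      Λ.derivWeierstrassP x - Λ.derivWeierstrassP k := by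
  have h1 := derivWeierstrassP_eq_mul hk hx (by rwa [add_comm]) hxk'
  have h2 := derivWeierstrassP_eq_mul hx hk hxk (by simpa using neg_notMem_lattice hxk')
  have h3 : zetaW Λ (k - x) = -zetaW Λ (x - k) := by rw [← zetaW_neg, neg_sub]
  rw [h3, add_comm k x] at h2
  rw [h1, h2]
  ring

lemma derivWeierstrassP_eventually_ne_zero {z : ℂ} (hz : z ∉ Λ.lattice) :
    ∀ᶠ w in 𝓝[≠] z, Λ.derivWeierstrassP w ≠ 0 := by
  rcases (Λ.analyticOnNhd_derivWeierstrassP z hz).eventually_eq_zero_or_eventually_ne_zero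
    with h | h
  · exfalso
    have h0 : Set.EqOn Λ.derivWeierstrassP 0 ((Λ.lattice : Set ℂ)ᶜ) :=
      Λ.analyticOnNhd_derivWeierstrassP.eqOn_zero_of_preconnected_of_eventuallyEq_zero
        (isPreconnected_compl_lattice Λ) hz h
    have h1 : ∀ w ∉ Λ.lattice, Λ.weierstrassP w = Λ.weierstrassP z := by
      intro w hw
      refine isOpen_compl_lattice.eqOn_of_deriv_eq (𝕜 := ℂ) (isPreconnected_compl_lattice Λ)
        (f := Λ.weierstrassP) (g := fun _ ↦ Λ.weierstrassP z)
        Λ.differentiableOn_weierstrassP (differentiableOn_const _) (fun w hw ↦ ?_) hz rfl hw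
      rw [Λ.deriv_weierstrassP, deriv_const, h0 hw]
      rfl
    have h2 := Λ.order_weierstrassP 0 (zero_mem _)
    have h3 : Λ.weierstrassP =ᶠ[𝓝[≠] (0 : ℂ)] fun _ ↦ Λ.weierstrassP z := by
      filter_upwards [eventually_notMem_lattice (Λ := Λ) 0 0] with w hw
      exact h1 w (by simpa using hw)
    rw [meromorphicOrderAt_congr h3] at h2
    have h4 : 0 ≤ meromorphicOrderAt (fun _ : ℂ ↦ Λ.weierstrassP z) 0 :=
      (analyticAt_const).meromorphicOrderAt_nonneg
    rw [h2] at h4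
    exact absurd h4 (by decide)
  · exact h

/-- `℘'' = 6 ℘² - g₂ / 2`: the derivative of the differential equation for `℘`, divided by `2℘'`,
whose zeros are isolated. -/
theorem hasDerivAt_derivWeierstrassP {z : ℂ} (hz : z ∉ Λ.lattice) :
    HasDerivAt Λ.derivWeierstrassP (6 * Λ.weierstrassP z ^ 2 - Λ.g₂ / 2) z := by
  have hd : ∀ w ∉ Λ.lattice, HasDerivAt Λ.derivWeierstrassP (deriv Λ.derivWeierstrassP w) w :=
    fun w hw ↦ (Λ.analyticOnNhd_derivWeierstrassP w hw).differentiableAt.hasDerivAt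
  have h1 : ∀ w ∉ Λ.lattice, Λ.derivWeierstrassP w ≠ 0 →
      deriv Λ.derivWeierstrassP w = 6 * Λ.weierstrassP w ^ 2 - Λ.g₂ / 2 := by
    intro w hw hne
    have h2 := (hd w hw).fun_pow 2
    have h3 := ((((hasDerivAt_weierstrassP hw).fun_pow 3).const_mul 4).fun_sub
      ((hasDerivAt_weierstrassP hw).const_mul Λ.g₂)).sub_const Λ.g₃
    have h4 := h2.unique (h3.congr_of_eventuallyEq ?_)
    · refine mul_left_cancel₀ (mul_ne_zero two_ne_zero hne) ?_
      simp only [Nat.cast_ofNat] at h4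
      linear_combination h4
    · filter_upwards [eventually_nhds_notMem_lattice hw] with v hv
      exact Λ.derivWeierstrassP_sq v hv
  have h2 : deriv Λ.derivWeierstrassP z = 6 * Λ.weierstrassP z ^ 2 - Λ.g₂ / 2 := by
    have ha := Λ.analyticOnNhd_weierstrassP z hz
    have hc1 : ContinuousAt (deriv Λ.derivWeierstrassP) z :=
      (Λ.analyticOnNhd_derivWeierstrassP z hz).deriv.continuousAt
    have hc2 : ContinuousAt (fun w ↦ 6 * Λ.weierstrassP w ^ 2 - Λ.g₂ / 2) z := by
      have := ha.continuousAt
      fun_prop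
    refine tendsto_nhds_unique (l := 𝓝[≠] z)
      ((hc1.tendsto.mono_left nhdsWithin_le_nhds).congr' ?_)
      (hc2.tendsto.mono_left nhdsWithin_le_nhds)
    filter_upwards [derivWeierstrassP_eventually_ne_zero hz,
      (eventually_nhds_notMem_lattice hz).filter_mono nhdsWithin_le_nhds] with w h3 h4
    exact h1 w h4 h3
  rw [← h2]
  exact hd z hz

/-- `(ζ(x+k) - ζ(x) - ζ(k))² = ℘(x) + ℘(k) + ℘(x+k)`: the derivative in `x` of
`two_mul_weierstrassP_sub_mul_zetaW`, after elimination of the derivatives of `℘`. -/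
theorem zetaW_add_sub_sq {x k : ℂ} (hx : x ∉ Λ.lattice) (hk : k ∉ Λ.lattice)
    (hxk : x + k ∉ Λ.lattice) (hxk' : x - k ∉ Λ.lattice) :
    (zetaW Λ (x + k) - zetaW Λ x - zetaW Λ k) ^ 2 =
      Λ.weierstrassP x + Λ.weierstrassP k + Λ.weierstrassP (x + k) := by
  have hB := two_mul_weierstrassP_sub_mul_zetaW hx hk hxk hxk'
  have hne := weierstrassP_sub_ne_zero hk hx (by rwa [add_comm]) hxk'
  have hxk'' : x + -k ∉ Λ.lattice := by rwa [← sub_eq_add_neg]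
  have h1 := (((hasDerivAt_weierstrassP hx).sub_const (Λ.weierstrassP k)).const_mul 2).fun_mul
    ((((hasDerivAt_zetaW hxk).comp_add_const x k).fun_sub (hasDerivAt_zetaW hx)).sub_const
      (zetaW Λ k))
  have h2 := (hasDerivAt_derivWeierstrassP hx).sub_const (Λ.derivWeierstrassP k)
  have h3 := h2.unique (h1.congr_of_eventuallyEq ?_)
  · have hsx := Λ.derivWeierstrassP_sq x hx
    have hsk := Λ.derivWeierstrassP_sq k hk
    set a := zetaW Λ (x + k) - zetaW Λ x - zetaW Λ k
    refine mul_left_cancel₀ (pow_ne_zero 2 hne) ?_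
    refine mul_left_cancel₀ (show (4 : ℂ) ≠ 0 by norm_num) ?_
    set P := Λ.weierstrassP x
    set Q := Λ.weierstrassP k
    set p := Λ.derivWeierstrassP x
    set q := Λ.derivWeierstrassP k
    linear_combination (2 * (P - Q) * a + (p - q)) * hB - 2 * (P - Q) * h3 - 2 * p * hB
      - hsx + hsk
  · filter_upwards [eventually_nhds_notMem_lattice hx, eventually_add_notMem_lattice hxk,
      eventually_add_notMem_lattice hxk''] with w h4 h5 h6
    exact (two_mul_weierstrassP_sub_mul_zetaW h4 hk h5 (by rwa [sub_eq_add_neg])).symm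

end EllipticDL
end

noncomputable section
namespace EllipticDL

open Filter Topology

variable {Λ : PeriodPair}

/-! ### Addition formulas with three arguments -/

/-- `℘(k) - ℘(l)` as a product of two instances of `zetaW_add_add_sub`. -/
theorem weierstrassP_sub_eq_mul {x k l : ℂ} (hx : x ∉ Λ.lattice) (hk : k ∉ Λ.lattice)
    (hl : l ∉ Λ.lattice) (hkl : k + l ∉ Λ.lattice) (hxk : x + k ∉ Λ.lattice)
    (hxl : x + l ∉ Λ.lattice) (hxkl : x + (k + l) ∉ Λ.lattice) :
    Λ.weierstrassP k - Λ.weierstrassP l =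
      (zetaW Λ x + zetaW Λ k + zetaW Λ l - zetaW Λ (x + (k + l))) *
        ((zetaW Λ (x + l) - zetaW Λ x - zetaW Λ l) -
          (zetaW Λ (x + k) - zetaW Λ x - zetaW Λ k)) := by
  have e1 : -(x + l) + l = -x := by ring
  have e2 : x + k + -x = k := by ring
  have e3 : x + k + -(x + l) = k - l := by ring
  have e4 : x + k + l = x + (k + l) := by ring
  have h1 := zetaW_add_add_sub hxk (neg_notMem_lattice hxl) hl
    (by rw [e1]; exact neg_notMem_lattice hx) (by rw [e1, e2]; exact hk)
  rw [e1, e2, e3, e4, zetaW_neg, sigmaW_neg, sigmaW_neg] at h1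
  have h2 : (zetaW Λ (x + l) - zetaW Λ x - zetaW Λ l) -
      (zetaW Λ (x + k) - zetaW Λ x - zetaW Λ k) =
      -(zetaW Λ (x + k) + -zetaW Λ (x + l) + zetaW Λ l - zetaW Λ k) := by ring
  rw [h2, h1, zetaW_add_add_sub hx hk hl hkl hxkl,
    weierstrassP_sub hl hk (by rwa [add_comm]), add_comm l k]
  have := sigmaW_ne_zero hx
  have := sigmaW_ne_zero hk
  have := sigmaW_ne_zero hl
  have := sigmaW_ne_zero hxk
  have := sigmaW_ne_zero hxl
  have := sigmaW_ne_zero hxkl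
  field_simp

/-- The derivative of `weierstrassP_sub_eq_mul` in the direction `(k, l) ↦ (k + t, l - t)`, which
keeps `x + k + l` fixed. -/
theorem derivWeierstrassP_add_eq_mul {x k l : ℂ} (hx : x ∉ Λ.lattice) (hk : k ∉ Λ.lattice)
    (hl : l ∉ Λ.lattice) (hkl : k + l ∉ Λ.lattice) (hxk : x + k ∉ Λ.lattice)
    (hxl : x + l ∉ Λ.lattice) (hxkl : x + (k + l) ∉ Λ.lattice) (hxk' : x - k ∉ Λ.lattice)
    (hxl' : x - l ∉ Λ.lattice) :
    Λ.derivWeierstrassP k + Λ.derivWeierstrassP l =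
      2 * (zetaW Λ x + zetaW Λ k + zetaW Λ l - zetaW Λ (x + (k + l))) *
        ((zetaW Λ (x + k) - zetaW Λ x - zetaW Λ k) * (zetaW Λ (x + l) - zetaW Λ x - zetaW Λ l) -
          Λ.weierstrassP x - Λ.weierstrassP k - Λ.weierstrassP l) := by
  -- `c + t` and `c - t` as functions of `t`, at `t = 0`
  have hplus : ∀ {f : ℂ → ℂ} {f' c : ℂ}, HasDerivAt f f' c →
      HasDerivAt (fun t ↦ f (c + t)) f' 0 := fun {f f' c} h ↦
    HasDerivAt.comp_const_add c 0 (by simpa using h)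
  have hminus : ∀ {f : ℂ → ℂ} {f' c : ℂ}, HasDerivAt f f' c →
      HasDerivAt (fun t ↦ f (c - t)) (-f') 0 := fun {f f' c} h ↦
    HasDerivAt.comp_const_sub c 0 (by simpa using h)
  have h1 := (hplus (hasDerivAt_weierstrassP hk)).fun_sub (hminus (hasDerivAt_weierstrassP hl))
  have h2 := ((((hplus (hasDerivAt_zetaW hk)).const_add (zetaW Λ x)).fun_add
    (hminus (hasDerivAt_zetaW hl))).sub_const (zetaW Λ (x + (k + l)))).fun_mul
    ((((hminus (hasDerivAt_zetaW hxl)).sub_const (zetaW Λ x)).fun_sub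
      (hminus (hasDerivAt_zetaW hl))).fun_sub
    (((hplus (hasDerivAt_zetaW hxk)).sub_const (zetaW Λ x)).fun_sub
      (hplus (hasDerivAt_zetaW hk))))
  have evp : ∀ {c : ℂ}, c ∉ Λ.lattice → ∀ᶠ t in 𝓝 (0 : ℂ), c + t ∉ Λ.lattice := fun {c} hc ↦
    (Continuous.tendsto (f := fun t : ℂ ↦ c + t) (by fun_prop) 0).eventually
      (eventually_nhds_notMem_lattice (by simpa using hc))
  have evm : ∀ {c : ℂ}, c ∉ Λ.lattice → ∀ᶠ t in 𝓝 (0 : ℂ), c - t ∉ Λ.lattice := fun {c} hc ↦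
    (Continuous.tendsto (f := fun t : ℂ ↦ c - t) (by fun_prop) 0).eventually
      (eventually_nhds_notMem_lattice (by simpa using hc))
  have h3 := h1.unique (h2.congr_of_eventuallyEq ?_)
  · simp only [add_zero, sub_zero] at h3
    have hk2 := zetaW_add_sub_sq hx hk hxk hxk'
    have hl2 := zetaW_add_sub_sq hx hl hxl hxl'
    have hF := weierstrassP_sub_eq_mul hx hk hl hkl hxk hxl hxkl
    set F := zetaW Λ x + zetaW Λ k + zetaW Λ l - zetaW Λ (x + (k + l))
    set a := zetaW Λ (x + k) - zetaW Λ x - zetaW Λ k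
    set b := zetaW Λ (x + l) - zetaW Λ x - zetaW Λ l
    linear_combination h3 - (b - a) * hF - F * hk2 - F * hl2
  · filter_upwards [evp hk, evm hl, evp hxk, evm hxl] with t h4 h5 h6 h7
    have e : k + t + (l - t) = k + l := by ring
    have h := weierstrassP_sub_eq_mul hx h4 h5 (by rwa [e])
      (by rwa [← add_assoc]) (by rwa [← add_sub_assoc]) (by rwa [e])
    rw [e, ← add_assoc x k t, ← add_sub_assoc] at h
    exact h

/-! ### Lamé functions on the shifted real line -/

lemma countable_setOf_add_mem_lattice (d : ℂ) :
    {X : ℝ | (X : ℂ) + d ∈ Λ.lattice}.Countable :=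
  (countable_lattice Λ).preimage (f := fun X : ℝ ↦ (X : ℂ) + d)
    ((add_left_injective d).comp Complex.ofReal_injective)

/-- Two continuous functions which agree off finitely many translates of the lattice agree. -/
lemma eq_of_forall_add_notMem {F G : ℝ → ℂ} (hF : Continuous F) (hG : Continuous G)
    (s : Finset ℂ) (h : ∀ X : ℝ, (∀ d ∈ s, (X : ℂ) + d ∉ Λ.lattice) → F X = G X) :
    ∀ X, F X = G X := by
  have hc : (⋃ d ∈ s, {X : ℝ | (X : ℂ) + d ∈ Λ.lattice}).Countable :=
    s.countable_toSet.biUnion fun d _ ↦ countable_setOf_add_mem_lattice d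
  refine congrFun (Continuous.ext_on (hc.dense_compl ℝ) hF hG fun X hX ↦ h X fun d hd hm ↦ ?_)
  exact hX (Set.mem_biUnion hd hm)

lemma contDiff_sigmaW_ofReal_add (d : ℂ) : ContDiff ℝ ∞ fun X : ℝ ↦ sigmaW Λ (X + d) := by
  have h1 : ContDiff ℝ ∞ (sigmaW Λ) :=
    ((differentiable_sigmaW Λ).contDiff (n := ∞)).restrict_scalars ℝ
  exact h1.comp (Complex.ofRealCLM.contDiff.add contDiff_const)

variable (Λ) in
/-- The shifted real line `ℝ + w'` contains no period. -/
def ShiftedLineRegular : Prop := ∀ X : ℝ, (X : ℂ) + halfPeriod' Λ ∉ Λ.lattice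

lemma contDiff_lame (hΛ : ShiftedLineRegular Λ) (k : ℂ) : ContDiff ℝ ∞ fun X : ℝ ↦ lame Λ X k := by
  have h1 : ContDiff ℝ ∞ fun X : ℝ ↦ (X : ℂ) := Complex.ofRealCLM.contDiff
  have h2 := (contDiff_sigmaW_ofReal_add (Λ := Λ) (halfPeriod' Λ)).inv
    fun X ↦ sigmaW_ne_zero (hΛ X)
  have h3 := contDiff_sigmaW_ofReal_add (Λ := Λ) (k + halfPeriod' Λ)
  have h4 : (fun X : ℝ ↦ lame Λ X k) = fun X : ℝ ↦
      sigmaW Λ (X + (k + halfPeriod' Λ)) * ((sigmaW Λ (X + halfPeriod' Λ))⁻¹ * (sigmaW Λ k)⁻¹) *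
    Complex.exp (-zetaW Λ k * X - zetaW Λ (halfPeriod' Λ) * k) := by
    ext X
    rw [lame, div_eq_mul_inv, mul_inv, add_assoc]
  rw [h4]
  exact (h3.mul (h2.mul contDiff_const)).mul (by fun_prop)

lemma contDiff_lame₂ (hΛ : ShiftedLineRegular Λ) (k l : ℂ) :
    ContDiff ℝ ∞ fun X : ℝ ↦ lame₂ Λ X k l := by
  have h1 : ContDiff ℝ ∞ fun X : ℝ ↦ (X : ℂ) := Complex.ofRealCLM.contDiff
  have h2 := (contDiff_sigmaW_ofReal_add (Λ := Λ) (halfPeriod' Λ)).inv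
    fun X ↦ sigmaW_ne_zero (hΛ X)
  have h3 := contDiff_sigmaW_ofReal_add (Λ := Λ) (k + l + halfPeriod' Λ)
  have h4 : (fun X : ℝ ↦ lame₂ Λ X k l) = fun X : ℝ ↦
      sigmaW Λ (X + (k + l + halfPeriod' Λ)) *
        ((sigmaW Λ (X + halfPeriod' Λ))⁻¹ * (sigmaW Λ (k + l))⁻¹) *
    Complex.exp (-(zetaW Λ k + zetaW Λ l) * X - zetaW Λ (halfPeriod' Λ) * (k + l)) := by
    ext X
    rw [lame₂, div_eq_mul_inv, mul_inv]
    simp only [add_assoc]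
  rw [h4]
  exact (h3.mul (h2.mul contDiff_const)).mul (by fun_prop)

lemma contDiff_weierstrassP_shift (hΛ : ShiftedLineRegular Λ) :
    ContDiff ℝ ∞ fun X : ℝ ↦ Λ.weierstrassP (X + halfPeriod' Λ) := by
  rw [contDiff_iff_contDiffAt]
  intro X
  have h1 : ContDiffAt ℝ ∞ Λ.weierstrassP ((X : ℂ) + halfPeriod' Λ) :=
    ((Λ.analyticOnNhd_weierstrassP _ (hΛ X)).contDiffAt (n := ∞)).restrict_scalars ℝ
  exact h1.comp X (Complex.ofRealCLM.contDiff.add contDiff_const).contDiffAt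

/-- Derivative along the shifted real line. -/
lemma _root_.HasDerivAt.comp_ofReal_add {f : ℂ → ℂ} {f' d : ℂ} {X : ℝ}
    (h : HasDerivAt f f' ((X : ℂ) + d)) : HasDerivAt (fun X : ℝ ↦ f ((X : ℂ) + d)) f' X :=
  (h.comp_add_const (X : ℂ) d).comp_ofReal

lemma lame_eq (X : ℝ) (k : ℂ) : lame Λ X k = sigmaW Λ (X + (halfPeriod' Λ + k)) /
    (sigmaW Λ (X + halfPeriod' Λ) * sigmaW Λ k) *
    Complex.exp (-zetaW Λ k * X - zetaW Λ (halfPeriod' Λ) * k) := by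
  rw [lame, add_assoc, add_comm k]

lemma lame₂_eq (X : ℝ) (k l : ℂ) : lame₂ Λ X k l = sigmaW Λ (X + (halfPeriod' Λ + (k + l))) /
    (sigmaW Λ (X + halfPeriod' Λ) * sigmaW Λ (k + l)) *
    Complex.exp (-(zetaW Λ k + zetaW Λ l) * X - zetaW Λ (halfPeriod' Λ) * (k + l)) := by
  rw [lame₂]
  congr 3
  ring

lemma hasDerivAt_cexp_linear (α β : ℂ) (X : ℝ) :
    HasDerivAt (fun X : ℝ ↦ Complex.exp (α * X - β)) (Complex.exp (α * X - β) * α) X := by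
  have h : HasDerivAt (fun z : ℂ ↦ Complex.exp (α * z - β)) (Complex.exp (α * X - β) * (α * 1)) X :=
    (((hasDerivAt_id' (X : ℂ)).const_mul α).sub_const β).cexp
  simpa using h.comp_ofReal

/-- Logarithmic derivative of `σ(x + d) / (σ(x) c) e^{αX - β}`, where `x = X + w'`. -/
lemma hasDerivAt_sigmaW_div {X : ℝ} (hX : (X : ℂ) + halfPeriod' Λ ∉ Λ.lattice) {d : ℂ}
    (hd : (X : ℂ) + (halfPeriod' Λ + d) ∉ Λ.lattice) {c : ℂ} (hc : c ≠ 0) (α β : ℂ) :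
    HasDerivAt (fun X : ℝ ↦ sigmaW Λ (X + (halfPeriod' Λ + d)) /
      (sigmaW Λ (X + halfPeriod' Λ) * c) * Complex.exp (α * X - β))
      ((zetaW Λ (X + (halfPeriod' Λ + d)) - zetaW Λ (X + halfPeriod' Λ) + α) *
        (sigmaW Λ (X + (halfPeriod' Λ + d)) /
      (sigmaW Λ (X + halfPeriod' Λ) * c) * Complex.exp (α * X - β))) X := by
  have h0 := sigmaW_ne_zero hX
  refine (((hasDerivAt_sigmaW hd).comp_ofReal_add.fun_div
    ((hasDerivAt_sigmaW hX).comp_ofReal_add.mul_const c) (mul_ne_zero h0 hc)).fun_mul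
    (hasDerivAt_cexp_linear α β X)).congr_deriv ?_
  field_simp

lemma hasDerivAt_lame {X : ℝ} {k : ℂ} (hX : (X : ℂ) + halfPeriod' Λ ∉ Λ.lattice)
    (hk : k ∉ Λ.lattice) (hXk : (X : ℂ) + (halfPeriod' Λ + k) ∉ Λ.lattice) :
    HasDerivAt (fun X : ℝ ↦ lame Λ X k) ((zetaW Λ (X + (halfPeriod' Λ + k)) -
      zetaW Λ (X + halfPeriod' Λ) - zetaW Λ k) * lame Λ X k) X := by
  simp only [lame_eq]
  exact (hasDerivAt_sigmaW_div hX hXk (sigmaW_ne_zero hk) _ _).congr_deriv (by ring)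

lemma lame_mul_lame {X : ℝ} {k l : ℂ} (hX : (X : ℂ) + halfPeriod' Λ ∉ Λ.lattice)
    (hk : k ∉ Λ.lattice) (hl : l ∉ Λ.lattice) (hkl : k + l ∉ Λ.lattice)
    (hXkl : (X : ℂ) + (halfPeriod' Λ + (k + l)) ∉ Λ.lattice) :
    lame Λ X k * lame Λ X l =
      (zetaW Λ (X + halfPeriod' Λ) + zetaW Λ k + zetaW Λ l -
        zetaW Λ (X + (halfPeriod' Λ + (k + l)))) * lame₂ Λ X k l := by
  have h := zetaW_add_add_sub hX hk hl hkl (by rwa [add_assoc])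
  simp only [add_assoc (X : ℂ)] at h
  rw [h, lame_eq, lame_eq, lame₂_eq]
  have he : Complex.exp (-(zetaW Λ k + zetaW Λ l) * X - zetaW Λ (halfPeriod' Λ) * (k + l)) =
      Complex.exp (-zetaW Λ k * X - zetaW Λ (halfPeriod' Λ) * k) *
      Complex.exp (-zetaW Λ l * X - zetaW Λ (halfPeriod' Λ) * l) := by
    rw [← Complex.exp_add]; ring_nf
  rw [he]
  have := sigmaW_ne_zero hX
  have := sigmaW_ne_zero hk
  have := sigmaW_ne_zero hl
  have := sigmaW_ne_zero hkl
  have := sigmaW_ne_zero hXkl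
  field_simp

lemma continuous_lame (hΛ : ShiftedLineRegular Λ) (k : ℂ) : Continuous fun X : ℝ ↦ lame Λ X k :=
  (contDiff_lame hΛ k).continuous

lemma continuous_lame₂ (hΛ : ShiftedLineRegular Λ) (k l : ℂ) :
    Continuous fun X : ℝ ↦ lame₂ Λ X k l :=
  (contDiff_lame₂ hΛ k l).continuous

lemma contDiff_deriv_lame (hΛ : ShiftedLineRegular Λ) (k : ℂ) :
    ContDiff ℝ ∞ (deriv fun X : ℝ ↦ lame Λ X k) :=
  (contDiff_infty_iff_deriv.mp (contDiff_lame hΛ k)).2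

lemma continuous_deriv_lame (hΛ : ShiftedLineRegular Λ) (k : ℂ) :
    Continuous (deriv fun X : ℝ ↦ lame Λ X k) :=
  (contDiff_deriv_lame hΛ k).continuous

/-- `∂_X Ψ̃(k, l) = -Ψ̃(k) Ψ̃(l)`. -/
theorem deriv_lame₂ (hΛ : ShiftedLineRegular Λ) {k l : ℂ} (hk : k ∉ Λ.lattice)
    (hl : l ∉ Λ.lattice) (hkl : k + l ∉ Λ.lattice) (X : ℝ) :
    deriv (fun X : ℝ ↦ lame₂ Λ X k l) X = -(lame Λ X k * lame Λ X l) := by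
  have h1 := continuous_lame hΛ k
  have h2 := continuous_lame hΛ l
  have h3 := (contDiff_infty_iff_deriv.mp (contDiff_lame₂ hΛ k l)).2.continuous
  revert X
  refine eq_of_forall_add_notMem (Λ := Λ) (by fun_prop) (by fun_prop) {halfPeriod' Λ + (k + l)}
    fun X hX ↦ ?_
  have hX' := hX _ (Finset.mem_singleton_self _)
  have h : HasDerivAt (fun X : ℝ ↦ lame₂ Λ X k l)
      ((zetaW Λ (X + (halfPeriod' Λ + (k + l))) - zetaW Λ (X + halfPeriod' Λ) +
        -(zetaW Λ k + zetaW Λ l)) * lame₂ Λ X k l) X := by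
    simp only [lame₂_eq]
    exact hasDerivAt_sigmaW_div (hΛ X) hX' (sigmaW_ne_zero hkl) _ _
  rw [h.deriv, lame_mul_lame (hΛ X) hk hl hkl hX']
  ring

lemma continuous_weierstrassP_shift (hΛ : ShiftedLineRegular Λ) :
    Continuous fun X : ℝ ↦ Λ.weierstrassP (X + halfPeriod' Λ) :=
  (contDiff_weierstrassP_shift hΛ).continuous

lemma continuous_derivWeierstrassP_shift (hΛ : ShiftedLineRegular Λ) :
    Continuous fun X : ℝ ↦ Λ.derivWeierstrassP (X + halfPeriod' Λ) := by
  rw [continuous_iff_continuousAt]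
  intro X
  exact ContinuousAt.comp (f := fun X : ℝ ↦ (X : ℂ) + halfPeriod' Λ)
    (Λ.analyticOnNhd_derivWeierstrassP _ (hΛ X)).continuousAt (by fun_prop)

/-- The first-order equation `2 (℘(x) - ℘(k)) Ψ̃' = (℘'(x) - ℘'(k)) Ψ̃`. -/
theorem two_mul_weierstrassP_sub_mul_deriv_lame (hΛ : ShiftedLineRegular Λ) {k : ℂ}
    (hk : k ∉ Λ.lattice) (X : ℝ) :
    2 * (Λ.weierstrassP (X + halfPeriod' Λ) - Λ.weierstrassP k) *
      deriv (fun X : ℝ ↦ lame Λ X k) X =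
    (Λ.derivWeierstrassP (X + halfPeriod' Λ) - Λ.derivWeierstrassP k) * lame Λ X k := by
  have h1 := continuous_lame hΛ k
  have h2 := continuous_deriv_lame hΛ k
  have h3 := continuous_weierstrassP_shift hΛ
  have h4 := continuous_derivWeierstrassP_shift hΛ
  revert X
  refine eq_of_forall_add_notMem (Λ := Λ) (by fun_prop) (by fun_prop)
    {halfPeriod' Λ + k, halfPeriod' Λ - k} fun X hX ↦ ?_
  have hX1 := hX (halfPeriod' Λ + k) (by simp)
  have hX2 := hX (halfPeriod' Λ - k) (by simp)
  rw [(hasDerivAt_lame (hΛ X) hk hX1).deriv]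
  have h := two_mul_weierstrassP_sub_mul_zetaW (hΛ X) hk (by rwa [add_assoc])
    (by rwa [add_sub_assoc])
  rw [add_assoc] at h
  linear_combination lame Λ X k * h

/-- The Lamé equation `Ψ̃'' = (2 ℘(x) + ℘(k)) Ψ̃`. -/
theorem deriv_deriv_lame (hΛ : ShiftedLineRegular Λ) {k : ℂ} (hk : k ∉ Λ.lattice) (X : ℝ) :
    deriv (deriv fun X : ℝ ↦ lame Λ X k) X =
      (2 * Λ.weierstrassP (X + halfPeriod' Λ) + Λ.weierstrassP k) * lame Λ X k := by
  have h1 := continuous_lame hΛ k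
  have h2 := (contDiff_infty_iff_deriv.mp (contDiff_deriv_lame hΛ k)).2.continuous
  have h3 := continuous_weierstrassP_shift hΛ
  revert X
  refine eq_of_forall_add_notMem (Λ := Λ) (by fun_prop) (by fun_prop)
    {halfPeriod' Λ + k, halfPeriod' Λ - k} fun X hX ↦ ?_
  have hX1 := hX (halfPeriod' Λ + k) (by simp)
  have hX2 := hX (halfPeriod' Λ - k) (by simp)
  have hev : deriv (fun X : ℝ ↦ lame Λ X k) =ᶠ[𝓝 X] fun X : ℝ ↦
      (zetaW Λ (X + (halfPeriod' Λ + k)) - zetaW Λ (X + halfPeriod' Λ) - zetaW Λ k) *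
        lame Λ X k := by
    have hc : Continuous fun X : ℝ ↦ (X : ℂ) + (halfPeriod' Λ + k) := by fun_prop
    filter_upwards [(hc.tendsto X).eventually (eventually_nhds_notMem_lattice hX1)] with X' hX'
    exact (hasDerivAt_lame (hΛ X') hk hX').deriv
  rw [hev.deriv_eq]
  have h := (((hasDerivAt_zetaW hX1).comp_ofReal_add.fun_sub
    (hasDerivAt_zetaW (hΛ X)).comp_ofReal_add).sub_const (zetaW Λ k)).fun_mul
    (hasDerivAt_lame (hΛ X) hk hX1)
  rw [h.deriv]
  have hsq := zetaW_add_sub_sq (hΛ X) hk (by rwa [add_assoc]) (by rwa [add_sub_assoc])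
  rw [add_assoc] at hsq
  linear_combination lame Λ X k * hsq

/-- The Wronskian of two Lamé functions. -/
theorem weierstrassP_sub_mul_lame₂ (hΛ : ShiftedLineRegular Λ) {k l : ℂ}
    (hk : k ∉ Λ.lattice) (hl : l ∉ Λ.lattice) (hkl : k + l ∉ Λ.lattice) (X : ℝ) :
    (Λ.weierstrassP k - Λ.weierstrassP l) * lame₂ Λ X k l =
      lame Λ X k * deriv (fun X : ℝ ↦ lame Λ X l) X -
        deriv (fun X : ℝ ↦ lame Λ X k) X * lame Λ X l := by
  have h1 := continuous_lame hΛ k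
  have h2 := continuous_deriv_lame hΛ k
  have h3 := continuous_lame hΛ l
  have h4 := continuous_deriv_lame hΛ l
  have h5 := continuous_lame₂ hΛ k l
  revert X
  refine eq_of_forall_add_notMem (Λ := Λ) (by fun_prop) (by fun_prop)
    {halfPeriod' Λ + k, halfPeriod' Λ + l, halfPeriod' Λ + (k + l)} fun X hX ↦ ?_
  have hX1 := hX (halfPeriod' Λ + k) (by simp)
  have hX2 := hX (halfPeriod' Λ + l) (by simp)
  have hX3 := hX (halfPeriod' Λ + (k + l)) (by simp)
  rw [(hasDerivAt_lame (hΛ X) hk hX1).deriv, (hasDerivAt_lame (hΛ X) hl hX2).deriv]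
  have h := weierstrassP_sub_eq_mul (hΛ X) hk hl hkl (by rwa [add_assoc]) (by rwa [add_assoc])
    (by rwa [add_assoc])
  simp only [add_assoc (X : ℂ)] at h
  have hm := lame_mul_lame (hΛ X) hk hl hkl hX3
  rw [h]
  linear_combination -(zetaW Λ (X + (halfPeriod' Λ + l)) - zetaW Λ l -
    zetaW Λ (X + (halfPeriod' Λ + k)) + zetaW Λ k) * hm

/-- The analogue of `weierstrassP_sub_mul_lame₂` for the third-order operator which commutes with
the Lamé operator and has the eigenvalue `℘'(k) / 2`. -/
theorem derivWeierstrassP_add_mul_lame₂ (hΛ : ShiftedLineRegular Λ) {k l : ℂ}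
    (hk : k ∉ Λ.lattice) (hl : l ∉ Λ.lattice) (hkl : k + l ∉ Λ.lattice) (X : ℝ) :
    (Λ.derivWeierstrassP k + Λ.derivWeierstrassP l) * lame₂ Λ X k l =
      -2 * ((Λ.weierstrassP (X + halfPeriod' Λ) + Λ.weierstrassP k + Λ.weierstrassP l) *
          (lame Λ X k * lame Λ X l) -
        deriv (fun X : ℝ ↦ lame Λ X k) X * deriv (fun X : ℝ ↦ lame Λ X l) X) := by
  have h1 := continuous_lame hΛ k
  have h2 := continuous_deriv_lame hΛ k
  have h3 := continuous_lame hΛ l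
  have h4 := continuous_deriv_lame hΛ l
  have h5 := continuous_lame₂ hΛ k l
  have h6 := continuous_weierstrassP_shift hΛ
  revert X
  refine eq_of_forall_add_notMem (Λ := Λ) (by fun_prop) (by fun_prop)
    {halfPeriod' Λ + k, halfPeriod' Λ + l, halfPeriod' Λ + (k + l), halfPeriod' Λ - k,
      halfPeriod' Λ - l} fun X hX ↦ ?_
  have hX1 := hX (halfPeriod' Λ + k) (by simp)
  have hX2 := hX (halfPeriod' Λ + l) (by simp)
  have hX3 := hX (halfPeriod' Λ + (k + l)) (by simp)
  have hX4 := hX (halfPeriod' Λ - k) (by simp)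
  have hX5 := hX (halfPeriod' Λ - l) (by simp)
  rw [(hasDerivAt_lame (hΛ X) hk hX1).deriv, (hasDerivAt_lame (hΛ X) hl hX2).deriv]
  have h := derivWeierstrassP_add_eq_mul (hΛ X) hk hl hkl (by rwa [add_assoc]) (by rwa [add_assoc])
    (by rwa [add_assoc]) (by rwa [add_sub_assoc]) (by rwa [add_sub_assoc])
  simp only [add_assoc (X : ℂ)] at h
  have hm := lame_mul_lame (hΛ X) hk hl hkl hX3
  rw [h]
  set a := zetaW Λ (X + (halfPeriod' Λ + k)) - zetaW Λ (X + halfPeriod' Λ) - zetaW Λ k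
  set b := zetaW Λ (X + (halfPeriod' Λ + l)) - zetaW Λ (X + halfPeriod' Λ) - zetaW Λ l
  linear_combination -2 * (a * b - Λ.weierstrassP (X + halfPeriod' Λ) - Λ.weierstrassP k -
    Λ.weierstrassP l) * hm

end EllipticDL
end

noncomputable section
namespace EllipticDL

open Filter Topology

/-! ### The differential algebra of smooth functions on the plane -/

/-- The smooth functions, as a subalgebra of all complex-valued functions of `(X, Y) ∈ ℝ²`. -/
def smoothSubalgebra : Subalgebra ℂ (ℝ × ℝ → ℂ) where
  carrier := {F | ContDiff ℝ ∞ F}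
  mul_mem' {f g} (ha : ContDiff ℝ ∞ f) (hb : ContDiff ℝ ∞ g) := ha.mul hb
  add_mem' {f g} (ha : ContDiff ℝ ∞ f) (hb : ContDiff ℝ ∞ g) := ha.add hb
  algebraMap_mem' c := (contDiff_const : ContDiff ℝ ∞ fun _ : ℝ × ℝ ↦ c)

/-- The algebra of smooth complex-valued functions of `(X, Y) ∈ ℝ²`. -/
abbrev SmoothFn : Type := smoothSubalgebra

namespace SmoothFn

lemma contDiff (F : SmoothFn) : ContDiff ℝ ∞ (F : ℝ × ℝ → ℂ) := F.2

lemma differentiable (F : SmoothFn) : Differentiable ℝ (F : ℝ × ℝ → ℂ) :=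
  F.contDiff.differentiable (by simp)

@[simp] lemma add_apply (F G : SmoothFn) (p : ℝ × ℝ) : (F + G).1 p = F.1 p + G.1 p := rfl
@[simp] lemma sub_apply (F G : SmoothFn) (p : ℝ × ℝ) : (F - G).1 p = F.1 p - G.1 p := rfl
@[simp] lemma mul_apply (F G : SmoothFn) (p : ℝ × ℝ) : (F * G).1 p = F.1 p * G.1 p := rfl
@[simp] lemma neg_apply (F : SmoothFn) (p : ℝ × ℝ) : (-F).1 p = -F.1 p := rfl
@[simp] lemma zero_apply (p : ℝ × ℝ) : (0 : SmoothFn).1 p = 0 := rfl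

/-- The constant function. -/
def const (c : ℂ) : SmoothFn := algebraMap ℂ SmoothFn c

@[simp] lemma const_apply (c : ℂ) (p : ℝ × ℝ) : (const c).1 p = c := rfl

lemma ext {F G : SmoothFn} (h : ∀ X Y : ℝ, F.1 (X, Y) = G.1 (X, Y)) : F = G :=
  Subtype.ext (funext fun p ↦ h p.1 p.2)

/-- The derivation of `SmoothFn` given by the constant vector field `v`. -/
def deriv (v : ℝ × ℝ) : Derivation ℂ SmoothFn SmoothFn :=
  Derivation.mk'
    { toFun := fun F ↦ ⟨fun p ↦ fderiv ℝ F.1 p v,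
        (F.contDiff.fderiv_right (m := ∞) (by simp)).clm_apply contDiff_const⟩
      map_add' := fun F G ↦ Subtype.ext <| funext fun p ↦ by
        have h : (F + G).1 = F.1 + G.1 := rfl
        simp [h, fderiv_add (F.differentiable p) (G.differentiable p)]
      map_smul' := fun c F ↦ Subtype.ext <| funext fun p ↦ by
        have h : (c • F).1 = c • F.1 := rfl
        have h' : ∀ G : SmoothFn, (c • G).1 p = c * G.1 p := fun _ ↦ rfl
        simp [h, h', fderiv_const_smul (F.differentiable p) c] }
    fun F G ↦ Subtype.ext <| funext fun p ↦ by
      have h : (F * G).1 = F.1 * G.1 := rfl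
      simp [h, fderiv_mul (F.differentiable p) (G.differentiable p)]

lemma deriv_apply (v : ℝ × ℝ) (F : SmoothFn) (p : ℝ × ℝ) :
    (deriv v F).1 p = fderiv ℝ F.1 p v := rfl

/-- `∂_X`. -/
def DX : Derivation ℂ SmoothFn SmoothFn := deriv (1, 0)

/-- `∂_Y`. -/
def DY : Derivation ℂ SmoothFn SmoothFn := deriv (0, 1)

lemma hasDerivAt_fst (F : SmoothFn) (X Y : ℝ) :
    HasDerivAt (fun x ↦ F.1 (x, Y)) ((DX F).1 (X, Y)) X := by
  have h := (F.differentiable (X, Y)).hasFDerivAt.comp_hasDerivAt X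
    ((hasDerivAt_id X).prodMk (hasDerivAt_const X Y))
  exact h

lemma hasDerivAt_snd (F : SmoothFn) (X Y : ℝ) :
    HasDerivAt (fun y ↦ F.1 (X, y)) ((DY F).1 (X, Y)) Y := by
  have h := (F.differentiable (X, Y)).hasFDerivAt.comp_hasDerivAt Y
    ((hasDerivAt_const Y X).prodMk (hasDerivAt_id Y))
  exact h

/-- Partial derivatives commute. -/
lemma DY_DX (F : SmoothFn) : DY (DX F) = DX (DY F) := by
  refine ext fun X Y ↦ ?_
  have h2 : DifferentiableAt ℝ (fderiv ℝ F.1) (X, Y) :=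
    (F.contDiff.fderiv_right (m := ∞) (by simp)).differentiable (by simp) _
  have h : ∀ v w : ℝ × ℝ, (deriv v (deriv w F)).1 (X, Y) =
      fderiv ℝ (fderiv ℝ F.1) (X, Y) v w := by
    intro v w
    have e : (deriv w F).1 = fun p ↦ fderiv ℝ F.1 p w := rfl
    rw [deriv_apply, e, fderiv_clm_apply h2 (differentiableAt_const w)]
    simp
  have hs : IsSymmSndFDerivAt ℝ F.1 (X, Y) :=
    F.contDiff.contDiffAt.isSymmSndFDerivAt (by
      rw [minSmoothness_of_isRCLikeNormedField]; exact WithTop.coe_le_coe.mpr le_top)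
  rw [DY, DX, h, h]
  exact hs _ _

@[simp] lemma DX_const (c : ℂ) : DX (const c) = 0 := DX.map_algebraMap c
@[simp] lemma DY_const (c : ℂ) : DY (const c) = 0 := DY.map_algebraMap c

@[simp] lemma DX_ofNat (n : ℕ) [n.AtLeastTwo] : DX (OfNat.ofNat n : SmoothFn) = 0 :=
  DX.map_natCast n

@[simp] lemma DY_ofNat (n : ℕ) [n.AtLeastTwo] : DY (OfNat.ofNat n : SmoothFn) = 0 :=
  DY.map_natCast n

lemma DX_mul (F G : SmoothFn) : DX (F * G) = F * DX G + G * DX F := DX.leibniz F G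
lemma DY_mul (F G : SmoothFn) : DY (F * G) = F * DY G + G * DY F := DY.leibniz F G

/-- A smooth function of `X` alone. -/
def ofFst (f : ℝ → ℂ) (hf : ContDiff ℝ ∞ f) : SmoothFn := ⟨fun p ↦ f p.1, hf.comp contDiff_fst⟩

/-- A smooth function of `Y` alone. -/
def ofSnd (f : ℝ → ℂ) (hf : ContDiff ℝ ∞ f) : SmoothFn := ⟨fun p ↦ f p.2, hf.comp contDiff_snd⟩

@[simp] lemma DY_ofFst (f : ℝ → ℂ) (hf : ContDiff ℝ ∞ f) : DY (ofFst f hf) = 0 :=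
  ext fun X Y ↦ ((ofFst f hf).hasDerivAt_snd X Y).unique (hasDerivAt_const Y (f X))

@[simp] lemma DX_ofSnd (f : ℝ → ℂ) (hf : ContDiff ℝ ∞ f) : DX (ofSnd f hf) = 0 :=
  ext fun X Y ↦ ((ofSnd f hf).hasDerivAt_fst X Y).unique (hasDerivAt_const X (f Y))

lemma DX_ofFst (f : ℝ → ℂ) (hf : ContDiff ℝ ∞ f) :
    DX (ofFst f hf) = ofFst (_root_.deriv f) (contDiff_infty_iff_deriv.mp hf).2 :=
  ext fun X Y ↦ ((ofFst f hf).hasDerivAt_fst X Y).deriv.symm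

lemma mixedDeriv_eq (F : SmoothFn) (a b : ℕ) (X Y : ℝ) :
    mixedDeriv a b (fun x y ↦ F.1 (x, y)) X Y = (DX^[a] (DY^[b] F)).1 (X, Y) := by
  have hY : ∀ b X Y, iteratedDeriv b (fun y ↦ F.1 (X, y)) Y = (DY^[b] F).1 (X, Y) := by
    intro b
    induction b with
    | zero => intro X Y; simp
    | succ b ih =>
      intro X Y
      rw [iteratedDeriv_succ, Function.iterate_succ_apply',
        ← ((DY^[b] F).hasDerivAt_snd X Y).deriv]
      congr 1
      exact funext fun y ↦ ih X y
  have hX : ∀ (G : SmoothFn) a X Y, iteratedDeriv a (fun x ↦ G.1 (x, Y)) X =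
      (DX^[a] G).1 (X, Y) := by
    intro G a
    induction a with
    | zero => intro X Y; simp
    | succ a ih =>
      intro X Y
      rw [iteratedDeriv_succ, Function.iterate_succ_apply',
        ← ((DX^[a] G).hasDerivAt_fst X Y).deriv]
      congr 1
      exact funext fun x ↦ ih x Y
  unfold mixedDeriv
  simp only [hY]
  exact hX _ a X Y

/-- A real-valued smooth function stays real under differentiation; this compares `∂_X` with the
partial derivative of real functions. -/
lemma DX_eq_ofReal {F : SmoothFn} {v : ℝ → ℝ → ℝ} (h : ∀ X Y, F.1 (X, Y) = (v X Y : ℂ)) (X Y : ℝ) :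
    (DX F).1 (X, Y) = (dX v X Y : ℂ) := by
  have h1 := F.hasDerivAt_fst X Y
  have h2 : HasDerivAt (fun x ↦ v x Y) ((DX F).1 (X, Y)).re X := by
    have e : (fun x ↦ v x Y) = fun x ↦ (F.1 (x, Y)).re := by simp [h]
    rw [e]
    exact Complex.reCLM.hasFDerivAt.comp_hasDerivAt X h1
  have h4 := h1.unique (by simpa only [h] using h2.ofReal_comp)
  rw [h4, dX, h2.deriv]

lemma DY_eq_ofReal {F : SmoothFn} {v : ℝ → ℝ → ℝ} (h : ∀ X Y, F.1 (X, Y) = (v X Y : ℂ)) (X Y : ℝ) :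
    (DY F).1 (X, Y) = (dY v X Y : ℂ) := by
  have h1 := F.hasDerivAt_snd X Y
  have h2 : HasDerivAt (fun y ↦ v X y) ((DY F).1 (X, Y)).re Y := by
    have e : (fun y ↦ v X y) = fun y ↦ (F.1 (X, y)).re := by simp [h]
    rw [e]
    exact Complex.reCLM.hasFDerivAt.comp_hasDerivAt Y h1
  have h4 := h1.unique (by simpa only [h] using h2.ofReal_comp)
  rw [h4, dY, h2.deriv]

/-! ### Compatibility of the Lax pair -/

/-- The zero-curvature expression of the Lax pair annihilates every joint solution: with
`A = ∂_X² + u` and `B = 4∂_X³ + 6u∂_X + q + b∂_Y`, the condition on `q` leaves only a function in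
the commutator of `∂_Y - A` and `B`. -/
theorem lax_compatibility {u q f : SmoothFn} {b c : ℂ}
    (hq : DX q = 3 * DY u + 3 * DX (DX u))
    (h₁ : DY f = DX (DX f) + u * f)
    (h₂ : 4 * DX (DX (DX f)) + 6 * (u * DX f) + q * f + const b * DY f = const c * f) :
    (DY q - 3 * DX (DY u) + DX (DX (DX u)) + 6 * (u * DX u) + const b * DY u) * f = 0 := by
  have hx := congrArg DX h₂
  have hy := congrArg DY h₂
  have e1 := congrArg DX h₁
  have ey := congrArg DY h₁
  have q2 := congrArg DX hq
  simp only [map_add, DX_mul, DY_mul, DX_ofNat 4, DX_ofNat 6, DX_ofNat 3, DY_ofNat 4, DY_ofNat 6,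
    DX_const, DY_const, mul_zero, add_zero, DY_DX] at hx hy e1 ey q2
  have hxx := congrArg DX hx
  have e2 := congrArg DX e1
  simp only [map_add, DX_mul, DX_ofNat 4, DX_ofNat 6, DX_const, mul_zero, add_zero] at hxx e2
  have e3 := congrArg DX e2
  simp only [map_add, DX_mul] at e3
  linear_combination hy - hxx - u * h₂ + const c * h₁ - 4 * e3 - 6 * u * e1 - q * h₁
    - const b * ey + 2 * DX f * hq + f * q2

end SmoothFn
end EllipticDL
end

noncomputable section
namespace EllipticDL

open Filter Topology SmoothFn

variable {Λ : PeriodPair}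

/-! ### The building blocks of the integral equation as smooth functions -/

/-- `Ψ̃_X(k)`. -/
def lameFn (hΛ : ShiftedLineRegular Λ) (k : ℂ) : SmoothFn :=
  ofFst (fun X ↦ lame Λ X k) (contDiff_lame hΛ k)

/-- `Ψ̃_X(k, l)`. -/
def lame₂Fn (hΛ : ShiftedLineRegular Λ) (k l : ℂ) : SmoothFn :=
  ofFst (fun X ↦ lame₂ Λ X k l) (contDiff_lame₂ hΛ k l)

/-- `℘(X + w')`. -/
def wpFn (hΛ : ShiftedLineRegular Λ) : SmoothFn :=
  ofFst (fun X ↦ Λ.weierstrassP (X + halfPeriod' Λ)) (contDiff_weierstrassP_shift hΛ)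

section

variable (hΛ : ShiftedLineRegular Λ)

@[simp] lemma lameFn_apply (k : ℂ) (p : ℝ × ℝ) : (lameFn hΛ k).1 p = lame Λ p.1 k := rfl
@[simp] lemma lame₂Fn_apply (k l : ℂ) (p : ℝ × ℝ) : (lame₂Fn hΛ k l).1 p = lame₂ Λ p.1 k l := rfl
@[simp] lemma wpFn_apply (p : ℝ × ℝ) :
    (wpFn hΛ).1 p = Λ.weierstrassP (p.1 + halfPeriod' Λ) := rfl

@[simp] lemma DY_lameFn (k : ℂ) : DY (lameFn hΛ k) = 0 := DY_ofFst _ _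
@[simp] lemma DY_lame₂Fn (k l : ℂ) : DY (lame₂Fn hΛ k l) = 0 := DY_ofFst _ _
@[simp] lemma DY_wpFn : DY (wpFn hΛ) = 0 := DY_ofFst _ _

lemma DX_lameFn_apply (k : ℂ) (p : ℝ × ℝ) :
    (DX (lameFn hΛ k)).1 p = deriv (fun X : ℝ ↦ lame Λ X k) p.1 := by
  rw [lameFn, DX_ofFst]; rfl

lemma DX_DX_lameFn_apply (k : ℂ) (p : ℝ × ℝ) :
    (DX (DX (lameFn hΛ k))).1 p = deriv (deriv fun X : ℝ ↦ lame Λ X k) p.1 := by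
  rw [lameFn, DX_ofFst, DX_ofFst]; rfl

lemma DX_wpFn_apply (p : ℝ × ℝ) :
    (DX (wpFn hΛ)).1 p = Λ.derivWeierstrassP (p.1 + halfPeriod' Λ) :=
  ((wpFn hΛ).hasDerivAt_fst p.1 p.2).unique (hasDerivAt_weierstrassP (hΛ p.1)).comp_ofReal_add

lemma DX_DX_wpFn : DX (DX (wpFn hΛ)) = 6 * wpFn hΛ ^ 2 - const (Λ.g₂ / 2) := by
  refine SmoothFn.ext fun X Y ↦ ?_
  refine ((DX (wpFn hΛ)).hasDerivAt_fst X Y).unique ?_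
  simp only [DX_wpFn_apply]
  exact (hasDerivAt_derivWeierstrassP (hΛ X)).comp_ofReal_add

lemma DX_lame₂Fn {k l : ℂ} (hk : k ∉ Λ.lattice) (hl : l ∉ Λ.lattice) (hkl : k + l ∉ Λ.lattice) :
    DX (lame₂Fn hΛ k l) = -(lameFn hΛ k * lameFn hΛ l) := by
  refine SmoothFn.ext fun X Y ↦ ?_
  rw [lame₂Fn, DX_ofFst]
  exact deriv_lame₂ hΛ hk hl hkl X

lemma DX_DX_lameFn {k : ℂ} (hk : k ∉ Λ.lattice) :
    DX (DX (lameFn hΛ k)) = (2 * wpFn hΛ + const (Λ.weierstrassP k)) * lameFn hΛ k := by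
  refine SmoothFn.ext fun X Y ↦ ?_
  rw [DX_DX_lameFn_apply]
  exact deriv_deriv_lame hΛ hk X

lemma two_mul_wpFn_sub_mul_DX_lameFn {k : ℂ} (hk : k ∉ Λ.lattice) :
    2 * (wpFn hΛ - const (Λ.weierstrassP k)) * DX (lameFn hΛ k) =
      (DX (wpFn hΛ) - const (Λ.derivWeierstrassP k)) * lameFn hΛ k := by
  refine SmoothFn.ext fun X Y ↦ ?_
  simp only [mul_apply, sub_apply, DX_lameFn_apply, DX_wpFn_apply, const_apply]
  exact two_mul_weierstrassP_sub_mul_deriv_lame hΛ hk X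

lemma const_sub_mul_lame₂Fn {k l : ℂ} (hk : k ∉ Λ.lattice) (hl : l ∉ Λ.lattice)
    (hkl : k + l ∉ Λ.lattice) :
    (const (Λ.weierstrassP k) - const (Λ.weierstrassP l)) * lame₂Fn hΛ k l =
      lameFn hΛ k * DX (lameFn hΛ l) - DX (lameFn hΛ k) * lameFn hΛ l := by
  refine SmoothFn.ext fun X Y ↦ ?_
  simp only [mul_apply, sub_apply, DX_lameFn_apply, const_apply]
  exact weierstrassP_sub_mul_lame₂ hΛ hk hl hkl X

lemma const_add_mul_lame₂Fn {k l : ℂ} (hk : k ∉ Λ.lattice) (hl : l ∉ Λ.lattice)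
    (hkl : k + l ∉ Λ.lattice) :
    (const (Λ.derivWeierstrassP k) + const (Λ.derivWeierstrassP l)) * lame₂Fn hΛ k l =
      -2 * ((wpFn hΛ + const (Λ.weierstrassP k) + const (Λ.weierstrassP l)) *
        (lameFn hΛ k * lameFn hΛ l) - DX (lameFn hΛ k) * DX (lameFn hΛ l)) := by
  refine SmoothFn.ext fun X Y ↦ ?_
  simp only [mul_apply, sub_apply, add_apply, neg_apply, DX_lameFn_apply, const_apply]
  exact derivWeierstrassP_add_mul_lame₂ hΛ hk hl hkl X

end

lemma contDiff_const_mul_cexp (a b : ℂ) : ContDiff ℝ ∞ fun Y : ℝ ↦ a * Complex.exp (b * Y) := by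
  have h1 : ContDiff ℝ ∞ fun Y : ℝ ↦ (Y : ℂ) := Complex.ofRealCLM.contDiff
  fun_prop

/-- The smooth function `a e^{bY}`. -/
def expFn (a b : ℂ) : SmoothFn := ofSnd _ (contDiff_const_mul_cexp a b)

@[simp] lemma expFn_apply (a b : ℂ) (p : ℝ × ℝ) :
    (expFn a b).1 p = a * Complex.exp (b * p.2) := rfl

@[simp] lemma DX_expFn (a b : ℂ) : DX (expFn a b) = 0 := DX_ofSnd _ _

lemma DY_expFn (a b : ℂ) : DY (expFn a b) = const b * expFn a b := by
  refine SmoothFn.ext fun X Y ↦ ?_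
  refine ((expFn a b).hasDerivAt_snd X Y).unique ?_
  have h := (hasDerivAt_cexp_linear b 0 Y).const_mul a
  simp only [sub_zero] at h
  exact h.congr_deriv (by simp; ring)

/-! ### The two Lax operators acting on the integrand -/

section integrand

variable {wp p s e c f u q : SmoothFn} {κ θ κ' θ' b : ℂ}

/-- The heat operator on `f`, times the kernel, in terms of derivatives of the integrands `f c e`
(of the integral equation) and `f c s` (of the potential). -/
lemma heat_mul_kernel (he : DX e = -(p * s)) (heY : DY e = 0) (hcX : DX c = 0)
    (hcY : DY c = -(const θ * c))
    (hW : (const κ - const θ) * e = p * DX s - DX p * s) :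
    (DY f - DX (DX f) - u * f) * c * e =
      DY (f * c * e) - DX (DX (f * c * e)) + const κ * (f * c * e) - 2 * p * DX (f * c * s) -
        u * (f * c * e) := by
  simp only [DX_mul, DY_mul, he, heY, hcX, hcY, map_add, map_neg, mul_zero, add_zero,
    map_zero]
  linear_combination -(f * c) * hW

/-- The analogue of `heat_mul_kernel` for the third-order operator. The eigenvalue on the left is
the one at the root `ω`; it is combined with the one at `k` by means of `hT`. -/
lemma thirdOrder_mul_kernel (he : DX e = -(p * s)) (heY : DY e = 0) (hsY : DY s = 0)
    (hcX : DX c = 0) (hcY : DY c = -(const θ * c))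
    (hp : DX (DX p) = (2 * wp + const κ) * p) (hs : DX (DX s) = (2 * wp + const θ) * s)
    (hT : (const κ' - const θ') * e =
      -2 * ((wp + const κ + const θ) * (p * s) - DX p * DX s))
    (hf : DY f = DX (DX f) + u * f) :
    (4 * DX (DX (DX f)) + 6 * u * DX f + q * f + const b * DY f -
        (2 * const θ' + const b * const θ) * f) * c * e =
      4 * DX (DX (DX (f * c * e))) + const b * DY (f * c * e) + 6 * u * DX (f * c * e) +
        (q - 2 * const κ') * (f * c * e) +
        6 * p * (DX (DX (f * c * s)) + DY (f * c * s)) + 12 * DX p * DX (f * c * s) := by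
  simp only [DX_mul, DY_mul, he, heY, hsY, hcX, hcY, map_add, map_neg, mul_zero, add_zero,
    map_zero, hp, hs]
  linear_combination (2 * f * c) * hT - 6 * p * c * s * hf

end integrand

/-! ### Differentiation under the integral sign -/

/-- `J` is the integral of the family `g` of smooth functions, pointwise in `(X, Y)`. -/
def IsIntegral (m : Measure ℂ) (g : ℂ → SmoothFn) (J : SmoothFn) : Prop :=
  ∀ X Y : ℝ, Integrable (fun l ↦ (g l).1 (X, Y)) m ∧ J.1 (X, Y) = ∫ l, (g l).1 (X, Y) ∂m

section IsIntegral

variable {m : Measure ℂ} {g g' : ℂ → SmoothFn} {J J' : SmoothFn}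

lemma IsIntegral.add (h : IsIntegral m g J) (h' : IsIntegral m g' J') :
    IsIntegral m (fun l ↦ g l + g' l) (J + J') := fun X Y ↦
  ⟨(h X Y).1.add (h' X Y).1, by
    simp only [add_apply]
    rw [integral_add (h X Y).1 (h' X Y).1, (h X Y).2, (h' X Y).2]⟩

lemma IsIntegral.sub (h : IsIntegral m g J) (h' : IsIntegral m g' J') :
    IsIntegral m (fun l ↦ g l - g' l) (J - J') := fun X Y ↦
  ⟨(h X Y).1.sub (h' X Y).1, by
    simp only [sub_apply]
    rw [integral_sub (h X Y).1 (h' X Y).1, (h X Y).2, (h' X Y).2]⟩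

lemma IsIntegral.mul_left (h : IsIntegral m g J) (F : SmoothFn) :
    IsIntegral m (fun l ↦ F * g l) (F * J) := fun X Y ↦
  ⟨(h X Y).1.const_mul _, by
    simp only [mul_apply]
    rw [integral_const_mul, (h X Y).2]⟩

lemma IsIntegral.congr (h : IsIntegral m g J) (hg : ∀ᵐ l ∂m, g l = g' l) :
    IsIntegral m g' J := fun X Y ↦ by
  have h1 : (fun l ↦ (g l).1 (X, Y)) =ᵐ[m] fun l ↦ (g' l).1 (X, Y) := by
    filter_upwards [hg] with l hl
    rw [hl]
  exact ⟨(h X Y).1.congr h1, by rw [(h X Y).2, integral_congr_ae h1]⟩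

variable {G : ℝ → ℝ → ℂ → ℂ}

lemma DiffUnderIntegral.contDiff_integral (h : DiffUnderIntegral m G) (a b : ℕ) :
    ContDiff ℝ ∞ fun p : ℝ × ℝ ↦ ∫ l, mixedDeriv a b (fun x y ↦ G x y l) p.1 p.2 ∂m := by
  rw [contDiff_infty]
  intro n
  induction n generalizing a b with
  | zero =>
    rw [Nat.cast_zero, contDiff_zero]
    exact continuous_iff_continuousAt.mpr fun p ↦ (h a b p.1 p.2).2.continuousAt
  | succ n ih =>
    rw [Nat.cast_succ, contDiff_succ_iff_hasFDerivAt]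
    refine ⟨_, ?_, fun p ↦ (h a b p.1 p.2).2⟩
    exact (contDiff_const.smulRight (ih (a + 1) b)).add (contDiff_const.smulRight (ih a (b + 1)))

/-- The integrals of the partial derivatives of `G`, as smooth functions. -/
def DiffUnderIntegral.integral (h : DiffUnderIntegral m G) (a b : ℕ) : SmoothFn :=
  ⟨_, h.contDiff_integral a b⟩

lemma DiffUnderIntegral.DX_integral (h : DiffUnderIntegral m G) (a b : ℕ) :
    DX (h.integral a b) = h.integral (a + 1) b := by
  refine SmoothFn.ext fun X Y ↦ ?_
  have h1 := (h a b X Y).2.fderiv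
  rw [DX, SmoothFn.deriv_apply]
  change fderiv ℝ (fun p : ℝ × ℝ ↦ ∫ l, mixedDeriv a b (fun x y ↦ G x y l) p.1 p.2 ∂m) (X, Y) _ = _
  rw [h1]
  simp [DiffUnderIntegral.integral]

lemma DiffUnderIntegral.DY_integral (h : DiffUnderIntegral m G) (a b : ℕ) :
    DY (h.integral a b) = h.integral a (b + 1) := by
  refine SmoothFn.ext fun X Y ↦ ?_
  have h1 := (h a b X Y).2.fderiv
  rw [DY, SmoothFn.deriv_apply]
  change fderiv ℝ (fun p : ℝ × ℝ ↦ ∫ l, mixedDeriv a b (fun x y ↦ G x y l) p.1 p.2 ∂m) (X, Y) _ = _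
  rw [h1]
  simp [DiffUnderIntegral.integral]

lemma DiffUnderIntegral.iterate_integral (h : DiffUnderIntegral m G) (a b : ℕ) :
    DX^[a] (DY^[b] (h.integral 0 0)) = h.integral a b := by
  have hY : DY^[b] (h.integral 0 0) = h.integral 0 b := by
    induction b with
    | zero => rfl
    | succ b ih => rw [Function.iterate_succ_apply', ih, h.DY_integral]
  rw [hY]
  induction a with
  | zero => rfl
  | succ a ih => rw [Function.iterate_succ_apply', ih, h.DX_integral]

lemma DiffUnderIntegral.isIntegral (h : DiffUnderIntegral m G)
    (hg : ∀ᵐ l ∂m, ∀ X Y, G X Y l = (g l).1 (X, Y)) (a b : ℕ) :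
    IsIntegral m (fun l ↦ DX^[a] (DY^[b] (g l))) (DX^[a] (DY^[b] (h.integral 0 0))) := by
  intro X Y
  have h1 : (fun l ↦ mixedDeriv a b (fun x y ↦ G x y l) X Y) =ᵐ[m]
      fun l ↦ (DX^[a] (DY^[b] (g l))).1 (X, Y) := by
    filter_upwards [hg] with l hl
    rw [← mixedDeriv_eq]
    simp only [hl]
  rw [h.iterate_integral]
  exact ⟨(h a b X Y).1.congr h1, integral_congr_ae h1⟩

end IsIntegral

end EllipticDL
end

noncomputable section
namespace EllipticDL

open Filter Topology SmoothFn

variable {Λ : PeriodPair} {S : SpectralData} {b₀ : ℝ} {ψ : ℝ → ℝ → ℂ → ℂ}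

/-! ### The Lax pair for solutions of the integral equation -/

lemma SpectralData.IsAdmissible.ae_mem (hS : S.IsAdmissible Λ b₀) (j : Fin 2) :
    ∀ᵐ l ∂(S.m j), l ∈ S.L j := mem_ae_iff.mpr (hS.measure_compl j)

/-- `μ_k(Y)` as a smooth function. -/
def muFn (S : SpectralData) (Λ : PeriodPair) (k : ℂ) : SmoothFn :=
  expFn (S.μ₀ k) (Λ.weierstrassP k)

/-- `γ_{-ω_j(l)}(Y) ρ_j(l)` as a smooth function. -/
def coeffFn (S : SpectralData) (Λ : PeriodPair) (j : Fin 2) (l : ℂ) : SmoothFn :=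
  expFn (S.γ₀ (S.root j l)) (-Λ.weierstrassP (S.root j l)) * const (S.ρ j l)

lemma muFn_apply (k : ℂ) (p : ℝ × ℝ) : (muFn S Λ k).1 p = S.mu Λ p.2 k := rfl

@[simp] lemma DX_muFn (k : ℂ) : DX (muFn S Λ k) = 0 := DX_expFn _ _

lemma DY_muFn (k : ℂ) : DY (muFn S Λ k) = const (Λ.weierstrassP k) * muFn S Λ k := DY_expFn _ _

@[simp] lemma DX_coeffFn (j : Fin 2) (l : ℂ) : DX (coeffFn S Λ j l) = 0 := by
  simp [coeffFn]

lemma DY_coeffFn (j : Fin 2) (l : ℂ) :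
    DY (coeffFn S Λ j l) = -(const (Λ.weierstrassP (S.root j l)) * coeffFn S Λ j l) := by
  have h : const (-Λ.weierstrassP (S.root j l)) = -const (Λ.weierstrassP (S.root j l)) :=
    map_neg (algebraMap ℂ SmoothFn) _
  rw [coeffFn, DY_mul, DY_const, DY_expFn, h]
  ring

lemma mul_coeffFn_mul_lame₂Fn_apply (hΛ : ShiftedLineRegular Λ) (f : SmoothFn) (j : Fin 2)
    (k l : ℂ) (X Y : ℝ) (φ : ℂ → ℂ) (hφ : φ l = f.1 (X, Y)) :
    S.eqIntegrand Λ j k X Y φ l = (f * coeffFn S Λ j l * lame₂Fn hΛ k (-S.root j l)).1 (X, Y) := by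
  simp only [SpectralData.eqIntegrand, SpectralData.gamma, coeffFn, mul_apply, expFn_apply,
    const_apply, lame₂Fn_apply, hφ]
  ring

lemma mul_coeffFn_mul_lameFn_apply (hΛ : ShiftedLineRegular Λ) (f : SmoothFn) (j : Fin 2)
    (l : ℂ) (X Y : ℝ) (φ : ℂ → ℂ) (hφ : φ l = f.1 (X, Y)) :
    S.potIntegrand Λ j X Y φ l = (f * coeffFn S Λ j l * lameFn hΛ (-S.root j l)).1 (X, Y) := by
  simp only [SpectralData.potIntegrand, SpectralData.gamma, coeffFn, mul_apply, expFn_apply,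
    const_apply, lameFn_apply, hφ]
  ring

/-- Uniqueness for the homogeneous equation, for families of smooth functions. -/
lemma SpectralData.HomogeneousUnique.eq_zero (hΛ : ShiftedLineRegular Λ)
    (hunique : S.HomogeneousUnique Λ) {φ : ℂ → SmoothFn} {J : Fin 2 → ℂ → SmoothFn}
    (hint : ∀ k ∈ S.K, ∀ j, IsIntegral (S.m j)
      (fun l ↦ φ l * coeffFn S Λ j l * lame₂Fn hΛ k (-S.root j l)) (J j k))
    (heq : ∀ k ∈ S.K, φ k + muFn S Λ k * (J 0 k + J 1 k) = 0) :
    ∀ k ∈ S.K, φ k = 0 := by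
  intro k hk
  refine SmoothFn.ext fun X Y ↦ ?_
  have hI : ∀ k j l, S.eqIntegrand Λ j k X Y (fun l ↦ (φ l).1 (X, Y)) l =
      (φ l * coeffFn S Λ j l * lame₂Fn hΛ k (-S.root j l)).1 (X, Y) := fun k j l ↦
    mul_coeffFn_mul_lame₂Fn_apply hΛ (φ l) j k l X Y _ rfl
  refine hunique X Y (fun l ↦ (φ l).1 (X, Y)) (fun k hk j ↦ ?_) (fun k hk ↦ ?_) k hk
  · exact (hint k hk j X Y).1.congr (.of_forall fun l ↦ (hI k j l).symm)
  · simp only [hI, Fin.sum_univ_two, ← (hint k hk _ X Y).2]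
    have h := congrArg (fun F : SmoothFn ↦ F.1 (X, Y)) (heq k hk)
    simpa [muFn_apply] using h

/-- A solution of the integral equation as a family `f` of smooth functions, together with
the integrals `I j k` of the equation and `V j` of the potential. -/
structure SmoothSolution (hΛ : ShiftedLineRegular Λ) (S : SpectralData)
    (ψ : ℝ → ℝ → ℂ → ℂ) where
  f : ℂ → SmoothFn
  I : Fin 2 → ℂ → SmoothFn
  V : Fin 2 → SmoothFn
  f_apply : ∀ k ∈ S.K, ∀ X Y, (f k).1 (X, Y) = ψ X Y k
  f_eq : ∀ k ∈ S.K, f k = muFn S Λ k * lameFn hΛ k - muFn S Λ k * (I 0 k + I 1 k)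
  isIntegral_I : ∀ j, ∀ k ∈ S.K, ∀ a b, IsIntegral (S.m j)
    (fun l ↦ DX^[a] (DY^[b] (f l * coeffFn S Λ j l * lame₂Fn hΛ k (-S.root j l))))
    (DX^[a] (DY^[b] (I j k)))
  isIntegral_V : ∀ j a b, IsIntegral (S.m j)
    (fun l ↦ DX^[a] (DY^[b] (f l * coeffFn S Λ j l * lameFn hΛ (-S.root j l))))
    (DX^[a] (DY^[b] (V j)))
  V_apply : ∀ j X Y, (V j).1 (X, Y) = ∫ l, S.potIntegrand Λ j X Y (ψ X Y) l ∂(S.m j)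

lemma nonempty_smoothSolution (hΛ : ShiftedLineRegular Λ) (hS : S.IsAdmissible Λ b₀)
    (hψ : S.SolvesIntegralEq Λ ψ) (hdiff : S.DerivativesCommute Λ ψ) :
    Nonempty (SmoothSolution hΛ S ψ) := by
  classical
  set I : Fin 2 → ℂ → SmoothFn := fun j k ↦
    if hk : k ∈ S.K then ((hdiff j).1 k hk).integral 0 0 else 0 with hI
  set f : ℂ → SmoothFn := fun k ↦
    muFn S Λ k * lameFn hΛ k - muFn S Λ k * (I 0 k + I 1 k) with hf
  have hIapply : ∀ j, ∀ k ∈ S.K, ∀ X Y, (I j k).1 (X, Y) =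
      ∫ l, S.eqIntegrand Λ j k X Y (ψ X Y) l ∂(S.m j) := by
    intro j k hk X Y
    simp only [hI, dif_pos hk]
    simp [DiffUnderIntegral.integral, mixedDeriv]
  have hfapply : ∀ k ∈ S.K, ∀ X Y, (f k).1 (X, Y) = ψ X Y k := by
    intro k hk X Y
    have h := hψ X Y k hk
    rw [Fin.sum_univ_two, ← hIapply 0 k hk, ← hIapply 1 k hk] at h
    simp only [hf, sub_apply, mul_apply, add_apply, muFn_apply, lameFn_apply]
    rw [← h]
    ring
  refine ⟨⟨f, I, fun j ↦ (hdiff j).2.integral 0 0, hfapply, fun k _ ↦ rfl, ?_, ?_, ?_⟩⟩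
  · intro j k hk a b
    simp only [hI, dif_pos hk]
    refine ((hdiff j).1 k hk).isIntegral ?_ a b
    filter_upwards [hS.ae_mem j] with l hl X Y
    exact mul_coeffFn_mul_lame₂Fn_apply hΛ (f l) j k l X Y _
      (hfapply l (hS.contour_subset j hl) X Y).symm
  · intro j a b
    refine (hdiff j).2.isIntegral ?_ a b
    filter_upwards [hS.ae_mem j] with l hl X Y
    exact mul_coeffFn_mul_lameFn_apply hΛ (f l) j l X Y _
      (hfapply l (hS.contour_subset j hl) X Y).symm
  · intro j X Y
    simp [DiffUnderIntegral.integral, mixedDeriv]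

namespace SmoothSolution

variable {hΛ : ShiftedLineRegular Λ} (T : SmoothSolution hΛ S ψ)

/-- The potential `u`. -/
def U : SmoothFn := -2 * wpFn hΛ - 2 * DX (T.V 0 + T.V 1)

/-- The zeroth-order coefficient of the third-order Lax operator; `∂_X Q = 3 (u_Y + u_XX)`. -/
def Q : SmoothFn :=
  -6 * DX (wpFn hΛ) - 6 * DX (DX (T.V 0 + T.V 1)) - 6 * DY (T.V 0 + T.V 1)

lemma U_apply (X Y : ℝ) : T.U.1 (X, Y) = S.potential Λ ψ X Y := by
  have h := (T.V 0 + T.V 1).hasDerivAt_fst X Y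
  simp only [add_apply, T.V_apply] at h
  have h2 : T.U.1 (X, Y) = -2 * (wpFn hΛ).1 (X, Y) - 2 * (DX (T.V 0 + T.V 1)).1 (X, Y) := rfl
  rw [h2, SpectralData.potential]
  simp only [Fin.sum_univ_two]
  rw [h.deriv]
  rfl

lemma DX_neg_ofNat (n : ℕ) [n.AtLeastTwo] : DX (-OfNat.ofNat n : SmoothFn) = 0 := by
  rw [map_neg, DX_ofNat, neg_zero]

lemma DY_neg_ofNat (n : ℕ) [n.AtLeastTwo] : DY (-OfNat.ofNat n : SmoothFn) = 0 := by
  rw [map_neg, DY_ofNat, neg_zero]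

lemma DX_Q : DX T.Q = 3 * DY T.U + 3 * DX (DX T.U) := by
  simp only [Q, U, map_sub, map_add, DX_mul, DY_mul, DX_neg_ofNat 2, DX_neg_ofNat 6, DX_ofNat 2,
    DX_ofNat 6, DY_ofNat 2, DY_neg_ofNat 2, DY_wpFn, mul_zero, add_zero, DY_DX]
  ring

/-- First Lax equation: the defect `ψ_Y - ψ_XX - uψ` solves the homogeneous integral equation. -/
theorem DY_f (hS : S.IsAdmissible Λ b₀) (hunique : S.HomogeneousUnique Λ) :
    ∀ k ∈ S.K, DY (T.f k) = DX (DX (T.f k)) + T.U * T.f k := by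
  suffices h : ∀ k ∈ S.K, DY (T.f k) - DX (DX (T.f k)) - T.U * T.f k = 0 from
    fun k hk ↦ by linear_combination h k hk
  refine hunique.eq_zero hΛ (φ := fun k ↦ DY (T.f k) - DX (DX (T.f k)) - T.U * T.f k)
    (J := fun j k ↦ DY (T.I j k) - DX (DX (T.I j k)) + const (Λ.weierstrassP k) * T.I j k -
      2 * lameFn hΛ k * DX (T.V j) - T.U * T.I j k) (fun k hk j ↦ ?_) (fun k hk ↦ ?_)
  · have hI := T.isIntegral_I j k hk
    have hV := T.isIntegral_V j
    refine IsIntegral.congr (((((hI 0 1).sub (hI 2 0)).add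
      ((hI 0 0).mul_left (const (Λ.weierstrassP k)))).sub
      ((hV 1 0).mul_left (2 * lameFn hΛ k))).sub ((hI 0 0).mul_left T.U)) ?_
    filter_upwards [hS.ae_mem j] with l hl
    have hk' := hS.notMem_lattice k hk
    have hω := neg_notMem_lattice (hS.root_notMem_lattice j l hl)
    have hkω : k + -S.root j l ∉ Λ.lattice := by
      rw [← sub_eq_add_neg]; exact hS.sub_root_notMem_lattice k hk j l hl
    have hW := const_sub_mul_lame₂Fn hΛ hk' hω hkω
    rw [Λ.weierstrassP_neg] at hW
    exact (heat_mul_kernel (DX_lame₂Fn hΛ hk' hω hkω) (DY_lame₂Fn hΛ _ _) (DX_coeffFn j l)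
      (DY_coeffFn j l) hW).symm
  · have hp := DX_DX_lameFn hΛ (hS.notMem_lattice k hk)
    simp only [T.f_eq k hk, U, map_sub, map_add, DX_mul, DY_mul, DX_muFn, DY_muFn, DY_lameFn,
      mul_zero, add_zero, zero_add, hp]
    ring

/-- Second Lax equation, by the same argument; here the equation satisfied by the roots `ω_j(l)`
enters. -/
theorem thirdOrder_f (hS : S.IsAdmissible Λ b₀) (hunique : S.HomogeneousUnique Λ) :
    ∀ k ∈ S.K, 4 * DX (DX (DX (T.f k))) + 6 * (T.U * DX (T.f k)) + T.Q * T.f k +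
      const b₀ * DY (T.f k) =
      const (2 * Λ.derivWeierstrassP k + b₀ * Λ.weierstrassP k) * T.f k := by
  have hf := T.DY_f hS hunique
  have hc : ∀ k, const (2 * Λ.derivWeierstrassP k + b₀ * Λ.weierstrassP k) =
      2 * const (Λ.derivWeierstrassP k) + const b₀ * const (Λ.weierstrassP k) := fun _ ↦ rfl
  suffices h : ∀ k ∈ S.K, 4 * DX (DX (DX (T.f k))) + 6 * T.U * DX (T.f k) + T.Q * T.f k +
      const b₀ * DY (T.f k) -
      const (2 * Λ.derivWeierstrassP k + b₀ * Λ.weierstrassP k) * T.f k = 0 from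
    fun k hk ↦ by linear_combination h k hk
  refine hunique.eq_zero hΛ
    (φ := fun k ↦ 4 * DX (DX (DX (T.f k))) + 6 * T.U * DX (T.f k) + T.Q * T.f k +
      const b₀ * DY (T.f k) -
      const (2 * Λ.derivWeierstrassP k + b₀ * Λ.weierstrassP k) * T.f k)
    (J := fun j k ↦ 4 * DX (DX (DX (T.I j k))) + const b₀ * DY (T.I j k) + 6 * T.U * DX (T.I j k) +
        (T.Q - 2 * const (Λ.derivWeierstrassP k)) * T.I j k +
        6 * lameFn hΛ k * (DX (DX (T.V j)) + DY (T.V j)) + 12 * DX (lameFn hΛ k) * DX (T.V j))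
    (fun k hk j ↦ ?_) (fun k hk ↦ ?_)
  · have hI := T.isIntegral_I j k hk
    have hV := T.isIntegral_V j
    refine IsIntegral.congr (((((((hI 3 0).mul_left 4).add ((hI 0 1).mul_left (const b₀))).add
      ((hI 1 0).mul_left (6 * T.U))).add
      ((hI 0 0).mul_left (T.Q - 2 * const (Λ.derivWeierstrassP k)))).add
      (((hV 2 0).add (hV 0 1)).mul_left (6 * lameFn hΛ k))).add
      ((hV 1 0).mul_left (12 * DX (lameFn hΛ k)))) ?_
    filter_upwards [hS.ae_mem j] with l hl
    have hk' := hS.notMem_lattice k hk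
    have hω := neg_notMem_lattice (hS.root_notMem_lattice j l hl)
    have hkω : k + -S.root j l ∉ Λ.lattice := by
      rw [← sub_eq_add_neg]; exact hS.sub_root_notMem_lattice k hk j l hl
    have hT := const_add_mul_lame₂Fn hΛ hk' hω hkω
    have hs := DX_DX_lameFn hΛ hω
    have hneg : const (-Λ.derivWeierstrassP (S.root j l)) =
        -const (Λ.derivWeierstrassP (S.root j l)) := map_neg (algebraMap ℂ SmoothFn) _
    rw [Λ.weierstrassP_neg] at hs hT
    rw [Λ.derivWeierstrassP_neg, hneg, ← sub_eq_add_neg] at hT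
    rw [← hS.root_eq j l hl, hc]
    exact (thirdOrder_mul_kernel (DX_lame₂Fn hΛ hk' hω hkω) (DY_lame₂Fn hΛ _ _) (DY_lameFn hΛ _)
      (DX_coeffFn j l) (DY_coeffFn j l) (DX_DX_lameFn hΛ hk') hs hT
      (hf l (hS.contour_subset j hl))).symm
  · have hk' := hS.notMem_lattice k hk
    have hp := DX_DX_lameFn hΛ hk'
    have hfirst := two_mul_wpFn_sub_mul_DX_lameFn hΛ hk'
    simp only [hc, T.f_eq k hk, U, Q, map_sub, map_add, DX_mul, DY_mul, DX_muFn, DY_muFn,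
      DY_lameFn, mul_zero, add_zero, zero_add, hp, DX_const, DX_ofNat 2]
    linear_combination (-2 * muFn S Λ k) * hfirst

/-- If all `μ₀(k)` vanish, then so does `ψ`, and the potential is the background `-2℘(X + w')`. -/
lemma V_eq_zero_of_mu_eq_zero (hS : S.IsAdmissible Λ b₀) (h : ∀ k ∈ S.K, S.μ₀ k = 0) :
    T.V 0 = 0 ∧ T.V 1 = 0 := by
  have hf : ∀ k ∈ S.K, T.f k = 0 := by
    intro k hk
    have hmu : muFn S Λ k = 0 := SmoothFn.ext fun X Y ↦ by simp [muFn, h k hk]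
    rw [T.f_eq k hk, hmu]
    ring
  have hV : ∀ j, T.V j = 0 := by
    intro j
    refine SmoothFn.ext fun X Y ↦ ?_
    have h1 := (T.isIntegral_V j 0 0 X Y).2
    have h2 : (fun l ↦ (T.f l * coeffFn S Λ j l * lameFn hΛ (-S.root j l)).1 (X, Y))
        =ᵐ[S.m j] fun _ ↦ 0 := by
      filter_upwards [hS.ae_mem j] with l hl
      rw [hf l (hS.contour_subset j hl)]
      simp
    exact h1.trans ((integral_congr_ae h2).trans (by simp))
  exact ⟨hV 0, hV 1⟩

/-- The equation for `u`, integrated once in `X`. The left-hand side annihilates all `ψ(·; k)`, and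
at a fixed `(X, Y)` these vanish simultaneously only if `Ψ̃_X(k)` does whenever `μ₀(k) ≠ 0`. -/
theorem integrated_equation (hS : S.IsAdmissible Λ b₀) (hunique : S.HomogeneousUnique Λ) :
    DY T.Q - 3 * DX (DY T.U) + DX (DX (DX T.U)) + 6 * (T.U * DX T.U) + const b₀ * DY T.U = 0 := by
  -- without a non-zero `ψ` the Lax pair says nothing, but then `u` is the background, for which the
  -- equation is the differential equation of `℘`
  by_cases hμ : ∀ k ∈ S.K, S.μ₀ k = 0
  · obtain ⟨h0, h1⟩ := T.V_eq_zero_of_mu_eq_zero hS hμ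
    have h2 := DX_DX_wpFn hΛ
    have h3 := congrArg DX h2
    simp only [pow_two, map_sub, DX_mul, DX_ofNat 6, DX_const, mul_zero, add_zero] at h3
    simp only [Q, U, h0, h1, map_zero, mul_zero, sub_zero, add_zero, DX_mul, DY_mul,
      DX_neg_ofNat 2, DY_neg_ofNat 2, DY_neg_ofNat 6, DY_wpFn, DY_DX]
    linear_combination -2 * h3
  · push Not at hμ
    obtain ⟨k₀, hk₀, hne⟩ := hμ
    set R := DY T.Q - 3 * DX (DY T.U) + DX (DX (DX T.U)) + 6 * (T.U * DX T.U) +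
      const b₀ * DY T.U with hR
    have hRf : ∀ k ∈ S.K, R * T.f k = 0 := fun k hk ↦
      lax_compatibility T.DX_Q (T.DY_f hS hunique k hk) (T.thirdOrder_f hS hunique k hk)
    refine SmoothFn.ext fun X Y ↦ ?_
    have hcont : Continuous fun X : ℝ ↦ R.1 (X, Y) := R.contDiff.continuous.comp (by fun_prop)
    revert X
    refine eq_of_forall_add_notMem (Λ := Λ) hcont continuous_const {halfPeriod' Λ + k₀}
      fun X hX ↦ ?_
    have hX' := hX _ (Finset.mem_singleton_self _)
    by_contra hRne
    -- otherwise `ψ(X, Y; k) = 0` for all `k`, so that the right-hand side `μ_k Ψ̃(k)` vanishes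
    have hf0 : ∀ k ∈ S.K, (T.f k).1 (X, Y) = 0 := by
      intro k hk
      have h := congrArg (fun F : SmoothFn ↦ F.1 (X, Y)) (hRf k hk)
      exact (mul_eq_zero.mp h).resolve_left hRne
    have hI0 : ∀ j, (T.I j k₀).1 (X, Y) = 0 := by
      intro j
      have h1 := (T.isIntegral_I j k₀ hk₀ 0 0 X Y).2
      have h2 : (fun l ↦ (T.f l * coeffFn S Λ j l * lame₂Fn hΛ k₀ (-S.root j l)).1 (X, Y))
          =ᵐ[S.m j] fun _ ↦ 0 := by
        filter_upwards [hS.ae_mem j] with l hl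
        simp [hf0 l (hS.contour_subset j hl)]
      exact h1.trans ((integral_congr_ae h2).trans (by simp))
    have h := hf0 k₀ hk₀
    rw [T.f_eq k₀ hk₀] at h
    simp only [sub_apply, mul_apply, add_apply, hI0, add_zero, mul_zero, sub_zero, muFn,
      expFn_apply, lameFn_apply, lame_eq] at h
    simp only [mul_eq_zero, div_eq_zero_iff, Complex.exp_ne_zero, hne, sigmaW_ne_zero hX',
      sigmaW_ne_zero (hΛ X), sigmaW_ne_zero (hS.notMem_lattice k₀ hk₀), or_self] at h

end SmoothSolution

end EllipticDL
end

noncomputable section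
namespace EllipticDL

open Filter Topology SmoothFn

variable {Λ : PeriodPair}

/-! ### Complex conjugation -/

/-- Complex conjugation on a lattice invariant under it. -/
def conjLattice (hΛ : ∀ l ∈ Λ.lattice, conj l ∈ Λ.lattice) : Λ.lattice ≃ Λ.lattice where
  toFun l := ⟨conj (l : ℂ), hΛ l l.2⟩
  invFun l := ⟨conj (l : ℂ), hΛ l l.2⟩
  left_inv _ := Subtype.ext (Complex.conj_conj _)
  right_inv _ := Subtype.ext (Complex.conj_conj _)

@[simp] lemma coe_conjLattice (hΛ : ∀ l ∈ Λ.lattice, conj l ∈ Λ.lattice) (l : Λ.lattice) :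
    (conjLattice hΛ l : ℂ) = conj (l : ℂ) := rfl

lemma weierstrassP_conj (hΛ : ∀ l ∈ Λ.lattice, conj l ∈ Λ.lattice) (z : ℂ) :
    Λ.weierstrassP (conj z) = conj (Λ.weierstrassP z) := by
  rw [PeriodPair.weierstrassP, PeriodPair.weierstrassP, Complex.conj_tsum,
    ← (conjLattice hΛ).tsum_eq]
  simp

lemma zetaW_conj (hΛ : ∀ l ∈ Λ.lattice, conj l ∈ Λ.lattice) (z : ℂ) :
    zetaW Λ (conj z) = conj (zetaW Λ z) := by
  rw [zetaW, zetaW, Complex.conj_tsum, ← (conjLattice hΛ).tsum_eq]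
  simp

lemma sigmaW_conj (hΛ : ∀ l ∈ Λ.lattice, conj l ∈ Λ.lattice) (z : ℂ) :
    sigmaW Λ (conj z) = conj (sigmaW Λ z) := by
  have hm : Multipliable fun l : Λ.lattice ↦ sigmaFactor l z :=
    (hasProdLocallyUniformlyOn_sigmaFactor Λ (r := ‖z‖ + 1) (by positivity)).hasProd
      (by simp) |>.multipliable
  have h := hm.map_tprod (starRingEnd ℂ) Complex.continuous_conj
  rw [sigmaW_eq, sigmaW_eq, sigmaProd, sigmaProd, map_mul, h, ← (conjLattice hΛ).tprod_eq]
  congr 2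
  ext l
  simp [sigmaFactor, ← Complex.exp_conj, map_ofNat (starRingEnd ℂ) 2]

/-- Quasi-periodicity of `σ` in the period `2w'`. -/
lemma sigmaW_add_ω₂ (z : ℂ) : sigmaW Λ (z + Λ.ω₂) =
    -sigmaW Λ z * Complex.exp (2 * zetaW Λ (halfPeriod' Λ) * (z + halfPeriod' Λ)) := by
  have hw : halfPeriod' Λ ∉ Λ.lattice := Λ.ω₂_div_two_notMem_lattice
  obtain ⟨η, C, hη, -, hσ⟩ := exists_sigmaW_add ⟨Λ.ω₂, Λ.ω₂_mem_lattice⟩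
  simp only at hη hσ
  have e : -halfPeriod' Λ + Λ.ω₂ = halfPeriod' Λ := by rw [halfPeriod']; ring
  have h1 := hη _ (neg_notMem_lattice hw)
  have h2 := hσ (-halfPeriod' Λ)
  rw [e, zetaW_neg] at h1
  rw [e, sigmaW_neg] at h2
  have h3 : η = 2 * zetaW Λ (halfPeriod' Λ) := by linear_combination -h1
  have h4 : C = -Complex.exp (η * halfPeriod' Λ) := by
    have h5 : C * Complex.exp (η * -halfPeriod' Λ) = -1 := by
      refine mul_left_cancel₀ (sigmaW_ne_zero hw) ?_
      linear_combination h2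
    have h6 : Complex.exp (η * -halfPeriod' Λ) * Complex.exp (η * halfPeriod' Λ) = 1 := by
      rw [← Complex.exp_add]; simp
    linear_combination Complex.exp (η * halfPeriod' Λ) * h5 - C * h6
  rw [hσ, h4, ← h3, mul_add, Complex.exp_add]
  ring

lemma sigmaW_conj_add (hconj : ∀ l ∈ Λ.lattice, conj l ∈ Λ.lattice)
    (hw' : conj (halfPeriod' Λ) = -halfPeriod' Λ) (X : ℝ) (d : ℂ) :
    sigmaW Λ (X + (halfPeriod' Λ + conj d)) = -conj (sigmaW Λ (X + (halfPeriod' Λ + d))) *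
      Complex.exp (2 * zetaW Λ (halfPeriod' Λ) * (X + conj d)) := by
  have h := sigmaW_add_ω₂ (Λ := Λ) (conj ((X : ℂ) + (halfPeriod' Λ + d)))
  rw [sigmaW_conj hconj] at h
  have e1 : conj ((X : ℂ) + (halfPeriod' Λ + d)) + Λ.ω₂ = X + (halfPeriod' Λ + conj d) := by
    simp only [map_add, Complex.conj_ofReal, hw']
    rw [halfPeriod']; ring
  have e2 : conj ((X : ℂ) + (halfPeriod' Λ + d)) + halfPeriod' Λ = X + conj d := by
    simp only [map_add, Complex.conj_ofReal, hw']
    ring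
  rwa [e1, e2] at h

lemma sigmaW_conj_add_div (hconj : ∀ l ∈ Λ.lattice, conj l ∈ Λ.lattice)
    (hw' : conj (halfPeriod' Λ) = -halfPeriod' Λ) (X : ℝ) (d : ℂ) :
    sigmaW Λ (X + (halfPeriod' Λ + conj d)) / sigmaW Λ (X + halfPeriod' Λ) =
      conj (sigmaW Λ (X + (halfPeriod' Λ + d)) / sigmaW Λ (X + halfPeriod' Λ)) *
      Complex.exp (2 * zetaW Λ (halfPeriod' Λ) * conj d) := by
  have h0 := sigmaW_conj_add hconj hw' X 0
  rw [map_zero, add_zero, add_zero] at h0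
  conv_lhs => rw [sigmaW_conj_add hconj hw', h0, mul_add, Complex.exp_add, neg_mul, neg_mul,
    neg_div_neg_eq, mul_comm (Complex.exp _), ← mul_assoc,
    mul_div_mul_right _ _ (Complex.exp_ne_zero _)]
  rw [map_div₀]
  ring

lemma conj_zetaW_halfPeriod' (hconj : ∀ l ∈ Λ.lattice, conj l ∈ Λ.lattice)
    (hw' : conj (halfPeriod' Λ) = -halfPeriod' Λ) :
    conj (zetaW Λ (halfPeriod' Λ)) = -zetaW Λ (halfPeriod' Λ) := by
  rw [← zetaW_conj hconj, hw', zetaW_neg]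

/-- The shifted Lamé functions are real on the real line. -/
lemma lame_conj (hconj : ∀ l ∈ Λ.lattice, conj l ∈ Λ.lattice)
    (hw' : conj (halfPeriod' Λ) = -halfPeriod' Λ) (X : ℝ) (k : ℂ) :
    lame Λ X (conj k) = conj (lame Λ X k) := by
  rw [lame_eq, lame_eq, ← div_div, ← div_div, sigmaW_conj_add_div hconj hw', map_mul,
    map_div₀ _ (_ / _) (sigmaW Λ k), sigmaW_conj hconj, ← Complex.exp_conj, map_sub, map_mul,
    map_mul, map_neg, Complex.conj_ofReal, conj_zetaW_halfPeriod' hconj hw', zetaW_conj hconj,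
    div_mul_eq_mul_div, div_mul_eq_mul_div, mul_assoc, ← Complex.exp_add]
  congr 3
  ring

lemma lame₂_conj (hconj : ∀ l ∈ Λ.lattice, conj l ∈ Λ.lattice)
    (hw' : conj (halfPeriod' Λ) = -halfPeriod' Λ) (X : ℝ) (k l : ℂ) :
    lame₂ Λ X (conj k) (conj l) = conj (lame₂ Λ X k l) := by
  rw [lame₂_eq, lame₂_eq, ← map_add, ← div_div, ← div_div, sigmaW_conj_add_div hconj hw', map_mul,
    map_div₀ _ (_ / _) (sigmaW Λ (k + l)), sigmaW_conj hconj, ← Complex.exp_conj, map_sub, map_mul,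
    map_mul, map_neg, map_add _ (zetaW Λ k), Complex.conj_ofReal,
    conj_zetaW_halfPeriod' hconj hw', zetaW_conj hconj, zetaW_conj hconj,
    div_mul_eq_mul_div, div_mul_eq_mul_div, mul_assoc, ← Complex.exp_add]
  congr 3
  ring

lemma integral_comp_conj {m : Measure ℂ} (hm : m.map (fun l : ℂ ↦ conj l) = m) (F : ℂ → ℂ) :
    ∫ l, F (conj l) ∂m = ∫ l, F l ∂m := by
  have h := (Complex.conjCLE.toHomeomorph.measurableEmbedding).integral_map (μ := m) F
  have e : (Complex.conjCLE.toHomeomorph : ℂ → ℂ) = fun l : ℂ ↦ conj l := rfl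
  rw [e, hm] at h
  exact h.symm

lemma Integrable.comp_conj {m : Measure ℂ} (hm : m.map (fun l : ℂ ↦ conj l) = m) {F : ℂ → ℂ}
    (hF : Integrable F m) : Integrable (fun l ↦ F (conj l)) m := by
  have h := (Complex.conjCLE.toHomeomorph.measurableEmbedding).integrable_map_iff (μ := m) (g := F)
  have e : (Complex.conjCLE.toHomeomorph : ℂ → ℂ) = fun l : ℂ ↦ conj l := rfl
  rw [e, hm] at h
  exact h.mp hF

section reality

variable {S : SpectralData} {b₀ : ℝ} {ψ : ℝ → ℝ → ℂ → ℂ}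

lemma gamma_conj (hconj : ∀ l ∈ Λ.lattice, conj l ∈ Λ.lattice) (hreal : S.IsReal) (j : Fin 2)
    {l : ℂ} (hl : l ∈ S.L j) (Y : ℝ) : S.gamma Λ j Y (conj l) = conj (S.gamma Λ j Y l) := by
  simp only [SpectralData.gamma, hreal.root_conj j l hl, hreal.gamma_conj j l hl, map_mul,
    ← Complex.exp_conj, map_neg, Complex.conj_ofReal, weierstrassP_conj hconj]

lemma mu_conj (hconj : ∀ l ∈ Λ.lattice, conj l ∈ Λ.lattice) (hreal : S.IsReal) {k : ℂ}
    (hk : k ∈ S.K) (Y : ℝ) : S.mu Λ Y (conj k) = conj (S.mu Λ Y k) := by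
  simp only [SpectralData.mu, hreal.mu_conj k hk, map_mul, ← Complex.exp_conj,
    Complex.conj_ofReal, weierstrassP_conj hconj]

lemma eqIntegrand_conj (hconj : ∀ l ∈ Λ.lattice, conj l ∈ Λ.lattice)
    (hw' : conj (halfPeriod' Λ) = -halfPeriod' Λ) (hreal : S.IsReal) (j : Fin 2)
    {l : ℂ} (hl : l ∈ S.L j) (k : ℂ) (X Y : ℝ) (φ : ℂ → ℂ) :
    S.eqIntegrand Λ j (conj k) X Y φ (conj l) =
      conj (S.eqIntegrand Λ j k X Y (fun l ↦ conj (φ (conj l))) l) := by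
  simp only [SpectralData.eqIntegrand, gamma_conj hconj hreal j hl, hreal.root_conj j l hl,
    hreal.density_conj j l hl, map_mul, Complex.conj_conj]
  rw [← lame₂_conj hconj hw', map_neg]

lemma potIntegrand_conj (hconj : ∀ l ∈ Λ.lattice, conj l ∈ Λ.lattice)
    (hw' : conj (halfPeriod' Λ) = -halfPeriod' Λ) (hreal : S.IsReal) (j : Fin 2)
    {l : ℂ} (hl : l ∈ S.L j) (X Y : ℝ) (φ : ℂ → ℂ) :
    S.potIntegrand Λ j X Y φ (conj l) =
      conj (S.potIntegrand Λ j X Y (fun l ↦ conj (φ (conj l))) l) := by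
  simp only [SpectralData.potIntegrand, gamma_conj hconj hreal j hl, hreal.root_conj j l hl,
    hreal.density_conj j l hl, map_mul, Complex.conj_conj]
  rw [← lame_conj hconj hw', map_neg]

/-- By uniqueness, the solution of an integral equation with real data is real. -/
theorem psi_conj (hconj : ∀ l ∈ Λ.lattice, conj l ∈ Λ.lattice)
    (hw' : conj (halfPeriod' Λ) = -halfPeriod' Λ) (hS : S.IsAdmissible Λ b₀) (hreal : S.IsReal)
    (hunique : S.HomogeneousUnique Λ) (hψ : S.SolvesIntegralEq Λ ψ)
    (hdiff : S.DerivativesCommute Λ ψ) (X Y : ℝ) {k : ℂ} (hk : k ∈ S.K) :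
    conj (ψ X Y (conj k)) = ψ X Y k := by
  have hint : ∀ k ∈ S.K, ∀ j, Integrable (S.eqIntegrand Λ j k X Y (ψ X Y)) (S.m j) := by
    intro k hk j
    have h := ((hdiff j).1 k hk 0 0 X Y).1
    simpa [mixedDeriv] using h
  have hae : ∀ k j, (fun l ↦ conj (S.eqIntegrand Λ j (conj k) X Y (ψ X Y) (conj l))) =ᵐ[S.m j]
      S.eqIntegrand Λ j k X Y (fun l ↦ conj (ψ X Y (conj l))) := by
    intro k j
    filter_upwards [hS.ae_mem j] with l hl
    rw [eqIntegrand_conj hconj hw' hreal j hl, Complex.conj_conj]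
  have hint' : ∀ k ∈ S.K, ∀ j,
      Integrable (S.eqIntegrand Λ j k X Y (fun l ↦ conj (ψ X Y (conj l)))) (S.m j) := by
    intro k hk j
    have h := Integrable.comp_conj (hreal.measure_conj j) (hint (conj k) (hreal.conj_mem k hk) j)
    refine Integrable.congr ?_ (hae k j)
    exact (Complex.conjLIE.integrable_comp_iff).mpr h
  have hI : ∀ k ∈ S.K, ∀ j,
      ∫ l, S.eqIntegrand Λ j k X Y (fun l ↦ conj (ψ X Y (conj l))) l ∂(S.m j) =
        conj (∫ l, S.eqIntegrand Λ j (conj k) X Y (ψ X Y) l ∂(S.m j)) := by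
    intro k hk j
    rw [← integral_congr_ae (hae k j), integral_conj,
      integral_comp_conj (hreal.measure_conj j) (S.eqIntegrand Λ j (conj k) X Y (ψ X Y))]
  have hsub : ∀ k j l, S.eqIntegrand Λ j k X Y (fun l ↦ conj (ψ X Y (conj l)) - ψ X Y l) l =
      S.eqIntegrand Λ j k X Y (fun l ↦ conj (ψ X Y (conj l))) l -
        S.eqIntegrand Λ j k X Y (ψ X Y) l := by
    intro k j l
    simp only [SpectralData.eqIntegrand]
    ring
  refine sub_eq_zero.mp (hunique X Y (fun l ↦ conj (ψ X Y (conj l)) - ψ X Y l) ?_ ?_ k hk)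
  · intro k hk j
    exact ((hint' k hk j).sub (hint k hk j)).congr (.of_forall fun l ↦ (hsub k j l).symm)
  · intro k hk
    have h1 := hψ X Y k hk
    have h2 := congrArg conj (hψ X Y (conj k) (hreal.conj_mem k hk))
    simp only [map_add, map_mul, map_sum, mu_conj hconj hreal hk, lame_conj hconj hw',
      Complex.conj_conj, ← hI k hk] at h2
    simp only [hsub]
    simp only [Fin.sum_univ_two, integral_sub (hint' k hk _) (hint k hk _)] at h1 h2 ⊢
    linear_combination h2 - h1

/-- The integrals in the potential are real. -/
lemma conj_integral_potIntegrand (hconj : ∀ l ∈ Λ.lattice, conj l ∈ Λ.lattice)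
    (hw' : conj (halfPeriod' Λ) = -halfPeriod' Λ) (hS : S.IsAdmissible Λ b₀) (hreal : S.IsReal)
    (hunique : S.HomogeneousUnique Λ) (hψ : S.SolvesIntegralEq Λ ψ)
    (hdiff : S.DerivativesCommute Λ ψ) (j : Fin 2) (X Y : ℝ) :
    conj (∫ l, S.potIntegrand Λ j X Y (ψ X Y) l ∂(S.m j)) =
      ∫ l, S.potIntegrand Λ j X Y (ψ X Y) l ∂(S.m j) := by
  conv_lhs => rw [← integral_comp_conj (hreal.measure_conj j), ← integral_conj]
  refine integral_congr_ae ?_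
  filter_upwards [hS.ae_mem j] with l hl
  rw [potIntegrand_conj hconj hw' hreal j hl, Complex.conj_conj]
  simp only [SpectralData.potIntegrand, psi_conj hconj hw' hS hreal hunique hψ hdiff X Y
    (hS.contour_subset j hl)]

end reality

/-! ### Rectangular lattices -/

section rectangular

variable {w h : ℝ}

lemma shiftedLineRegular_of_rectangular (hh : 0 < h) (hω₁ : Λ.ω₁ = 2 * (w : ℂ))
    (hω₂ : Λ.ω₂ = 2 * (Complex.I * (h : ℂ))) : ShiftedLineRegular Λ := by
  intro X hX
  obtain ⟨m, n, e⟩ := PeriodPair.mem_lattice.mp hX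
  have h1 := congrArg Complex.im e
  simp [halfPeriod', hω₁, hω₂] at h1
  have h2 : (2 * n - 1 : ℝ) * h = 0 := by linarith
  have h3 : (2 * n - 1 : ℝ) = 0 := (mul_eq_zero.mp h2).resolve_right hh.ne'
  have h4 : 2 * n - 1 = 0 := by exact_mod_cast h3
  omega

lemma conj_mem_lattice_of_rectangular (hω₁ : Λ.ω₁ = 2 * (w : ℂ))
    (hω₂ : Λ.ω₂ = 2 * (Complex.I * (h : ℂ))) : ∀ l ∈ Λ.lattice, conj l ∈ Λ.lattice := by
  intro l hl
  obtain ⟨m, n, rfl⟩ := PeriodPair.mem_lattice.mp hl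
  refine PeriodPair.mem_lattice.mpr ⟨m, -n, ?_⟩
  simp [hω₁, hω₂, map_ofNat (starRingEnd ℂ) 2]

lemma conj_halfPeriod'_of_rectangular (hω₂ : Λ.ω₂ = 2 * (Complex.I * (h : ℂ))) :
    conj (halfPeriod' Λ) = -halfPeriod' Λ := by
  simp [halfPeriod', hω₂]

end rectangular

end EllipticDL
end

theorem theorem7 (Λ : PeriodPair) (g₂ g₃ : ℝ) (hg₂ : Λ.g₂ = (g₂ : ℂ)) (hg₃ : Λ.g₃ = (g₃ : ℂ))
    (hΔ : 0 < g₂ ^ 3 - 27 * g₃ ^ 2)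
    (w h : ℝ) (hw : 0 < w) (hh : 0 < h)
    (hω₁ : Λ.ω₁ = 2 * (w : ℂ)) (hω₂ : Λ.ω₂ = 2 * (Complex.I * (h : ℂ)))
    (b₀ : ℝ) (S : EllipticDL.SpectralData) (hS : S.IsAdmissible Λ b₀) (hreal : S.IsReal)
    (hunique : S.HomogeneousUnique Λ)
    (ψ : ℝ → ℝ → ℂ → ℂ) (hψ : S.SolvesIntegralEq Λ ψ) (hdiff : S.DerivativesCommute Λ ψ) :
    ∃ v : ℝ → ℝ → ℝ,
      (∀ X Y : ℝ, S.potential Λ ψ X Y = (v X Y : ℂ)) ∧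
      ContDiff ℝ ∞ (fun p : ℝ × ℝ => v p.1 p.2) ∧
      EllipticDL.SolvesExtendedBoussinesq b₀ v := by
  open EllipticDL EllipticDL.SmoothFn in
  have hΛ : ShiftedLineRegular Λ := shiftedLineRegular_of_rectangular hh hω₁ hω₂
  have hconj := conj_mem_lattice_of_rectangular hω₁ hω₂
  have hw' := conj_halfPeriod'_of_rectangular hω₂
  obtain ⟨T⟩ := nonempty_smoothSolution hΛ hS hψ hdiff
  -- the potential is real because its ingredients are
  have hwp : ∀ X Y, (wpFn hΛ).1 (X, Y) = (((wpFn hΛ).1 (X, Y)).re : ℂ) := by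
    intro X Y
    refine (Complex.conj_eq_iff_re.mp ?_).symm
    have e : conj ((X : ℂ) + halfPeriod' Λ) = (X + halfPeriod' Λ) - Λ.ω₂ := by
      rw [map_add, hw', Complex.conj_ofReal, halfPeriod']; ring
    rw [wpFn_apply, ← weierstrassP_conj hconj, e]
    exact Λ.weierstrassP_sub_coe _ ⟨_, Λ.ω₂_mem_lattice⟩
  have hV : ∀ X Y, (T.V 0 + T.V 1).1 (X, Y) = (((T.V 0 + T.V 1).1 (X, Y)).re : ℂ) := by
    intro X Y
    refine (Complex.conj_eq_iff_re.mp ?_).symm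
    simp only [SmoothFn.add_apply, T.V_apply, map_add,
      conj_integral_potIntegrand hconj hw' hS hreal hunique hψ hdiff]
  have hDV := DX_eq_ofReal (v := fun X Y ↦ ((T.V 0 + T.V 1).1 (X, Y)).re) hV
  set v : ℝ → ℝ → ℝ := fun X Y ↦ (T.U.1 (X, Y)).re with hv
  have hU : ∀ X Y, T.U.1 (X, Y) = (v X Y : ℂ) := by
    intro X Y
    refine (Complex.conj_eq_iff_re.mp ?_).symm
    have h2 : T.U.1 (X, Y) = -2 * (wpFn hΛ).1 (X, Y) - 2 * (DX (T.V 0 + T.V 1)).1 (X, Y) := rfl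
    rw [h2, hwp, hDV]
    simp only [map_sub, map_mul, map_neg, map_ofNat, Complex.conj_ofReal]
  refine ⟨v, fun X Y ↦ by rw [← T.U_apply, hU], ?_, ?_⟩
  · exact Complex.reCLM.contDiff.comp T.U.contDiff
  · intro X Y
    have h1 := DX_eq_ofReal hU
    have h2 := DX_eq_ofReal h1
    have h3 := DX_eq_ofReal h2
    have hY := DY_eq_ofReal hU
    have hYY := DY_eq_ofReal hY
    have hW : ∀ X Y, (const (b₀ : ℂ) * DY T.U + DX (DX (DX T.U)) + 6 * T.U * DX T.U).1 (X, Y) =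
        ((b₀ * dY v X Y + dX (dX (dX v)) X Y + 6 * v X Y * dX v X Y : ℝ) : ℂ) := by
      intro X Y
      -- the numeral `6` is the constant function by definition, so that `rfl` closes the goal
      simp only [SmoothFn.add_apply, SmoothFn.mul_apply, SmoothFn.const_apply, hU, h1, h3, hY]
      push_cast
      rfl
    have hDW := DX_eq_ofReal
      (v := fun x y ↦ b₀ * dY v x y + dX (dX (dX v)) x y + 6 * v x y * dX v x y) hW X Y
    have hEq := congrArg DX (T.integrated_equation hS hunique)
    have hQ := congrArg DY T.DX_Q
    -- `Q` is eliminated by its equation `∂_X Q = 3 (u_Y + u_XX)`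
    have hkey : DX (const (b₀ : ℂ) * DY T.U + DX (DX (DX T.U)) + 6 * T.U * DX T.U) +
        3 * DY (DY T.U) = 0 := by
      simp only [map_add, map_sub, map_zero, DX_mul, DY_mul, DX_ofNat 3, DX_ofNat 6, DY_ofNat 3,
        DX_const, mul_zero, add_zero, DY_DX] at hEq hQ ⊢
      linear_combination hEq - hQ
    have h4 := congrArg (fun F : SmoothFn ↦ F.1 (X, Y)) hkey
    simp only [SmoothFn.add_apply, SmoothFn.mul_apply, SmoothFn.zero_apply] at h4
    have h5 : (DX (const (b₀ : ℂ) * DY T.U + DX (DX (DX T.U)) + 6 * T.U * DX T.U)).1 (X, Y) +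
        3 * (DY (DY T.U)).1 (X, Y) = 0 := h4
    rw [hDW, hYY] at h5
    exact_mod_cast h5
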